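/- All manifolds, maps, forms and vector fields are smooth. A Jacobi structure on a manifold $M$ is a pair $(\pi,E)$ of a bivector field $\pi$ and a vector field $E$ with $[\pi,\pi]=2E\wedge\pi$ and $[E,\pi]=0$, where the Schouten bracket has the sign for which $[\pi,\pi](df,dg,dh)=2\big(\{\{f,g\},h\}+\{\{g,h\},f\}+\{\{h,f\},g\}\big)$ with $\{f,g\}=\pi(df,dg)$. Write $\pi^\sharp\alpha$ for the vector with $\langle\beta,\pi^\sharp\alpha\rangle=\pi(\alpha,\beta)$, and let $$(\pi,E)^\sharp:T^*M\times\mathbb R\to TM\times\mathbb R,\qquad (\alpha,g)\mapsto(\pi^\sharp\alpha+gE,\,-\langle\alpha,E\rangle).$$ A Jacobi map $\phi:(\widetilde M,\widetilde\pi,\widetilde E)\to(M,\pi,E)$ between Jacobi manifolds is a smooth map with $\phi_*\widetilde\pi=\pi$ and $\phi_*\widetilde E=E$, i.e. $\widetilde\pi_x(\phi^*\alpha,\phi^*\beta)=\pi_{\phi(x)}(\alpha,\beta)$ and $d_x\phi(\widetilde E_x)=E_{\phi(x)}$ for all $x\in\widetilde M$ and $\alpha,\beta\in T^*_{\phi(x)}M$.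 A contact form on a manifold $G$ of dimension $2n+1$ is a $1$-form $\eta$ with $\eta\wedge(d\eta)^n\neq0$ at every point. Then $\flat_\eta(X)=i_Xd\eta+\eta(X)\eta$ is an isomorphism $TG\to T^*G$, and $(G,\eta)$ is regarded as a Jacobi manifold with the Jacobi structure $$\pi_\eta(\alpha,\beta)=d\eta(\flat_\eta^{-1}\alpha,\flat_\eta^{-1}\beta),\qquad E_\eta=\flat_\eta^{-1}(\eta).$$ For a $1$-form $B$ on a Jacobi manifold $(M,\pi,E)$ let $\widetilde{(dB,B)}:TM\times\mathbb R\to T^*M\times\mathbb R$, $(X,f)\mapsto(i_XdB+fB,\,-B(X))$. The form $B$ is called $(\pi,E)$-admissible if the bundle map $\mathrm{Id}+\widetilde{(dB,B)}\circ(\pi,E)^\sharp$ of $T^*M\times\mathbb R$ is invertible. In that case the gauge transformation $\tau_B(\pi,E)=(\pi_B,E_B)$ is the pair of a bivector field and a vector field determined by $$(\pi_B,E_B)^\sharp=(\pi,E)^\sharp\circ\big(\mathrm{Id}+\widetilde{(dB,B)}\circ(\pi,E)^\sharp\big)^{-1}.$$ **Proposition.** Let $\eta$ be a contact form on $G$,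 let $(M,\pi,E)$ be a Jacobi manifold, let $\phi:(G,\eta)\to(M,\pi,E)$ be a Jacobi map, and let $B\in\Omega^1(M)$ be $(\pi,E)$-admissible. Then $\widehat\eta=\eta-\phi^*B$ is a contact form on $G$, and $\phi:(G,\widehat\eta)\to(M,\tau_B(\pi,E))$ is a Jacobi map between Jacobi manifolds; in particular $(\pi_{\widehat\eta},E_{\widehat\eta})$ and $\tau_B(\pi,E)$ are Jacobi structures. -/

import Mathlib

open scoped Manifold ContDiff

set_option maxSynthPendingDepth 3

noncomputable section

namespace JacobiGeometry

/-! ### Linear algebra at one point -/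

section LinearAlgebra

variable {W : Type*} [NormedAddCommGroup W] [NormedSpace ℝ W]

/-- `P♯ : W* → W` for a bilinear form `P` on `W*`: the vector `P♯ α` with `β (P♯ α) = P α β` for
all `β` (the canonical map `W → W**` is invertible as `W` is finite-dimensional). -/
def sharp (P : (W →L[ℝ] ℝ) →L[ℝ] (W →L[ℝ] ℝ) →L[ℝ] ℝ) : (W →L[ℝ] ℝ) →L[ℝ] W :=
  (NormedSpace.inclusionInDoubleDual ℝ W).inverse ∘L P

/-- `(P, e)♯ (α, g) = (P♯ α + g e, - α(e))`. -/
def pairSharp (P : (W →L[ℝ] ℝ) →L[ℝ] (W →L[ℝ] ℝ) →L[ℝ] ℝ) (e : W) :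
    ((W →L[ℝ] ℝ) × ℝ) →L[ℝ] W × ℝ :=
  ((sharp P).coprod ((ContinuousLinearMap.id ℝ ℝ).smulRight e)).prod
    (-(NormedSpace.inclusionInDoubleDual ℝ W e ∘L ContinuousLinearMap.fst ℝ (W →L[ℝ] ℝ) ℝ))

/-- The contraction `(X, f) ↦ i_(X,f) (θ, b) = (i_X θ + f b, - b(X))`. -/
def pairFlat (θ : W →L[ℝ] W →L[ℝ] ℝ) (b : W →L[ℝ] ℝ) :
    (W × ℝ) →L[ℝ] (W →L[ℝ] ℝ) × ℝ :=
  (θ.coprod ((ContinuousLinearMap.id ℝ ℝ).smulRight b)).prod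
    (-(b ∘L ContinuousLinearMap.fst ℝ W ℝ))

/-- `Id + (θ, b)~ ∘ (P, e)♯`. -/
def gaugeEndo (θ : W →L[ℝ] W →L[ℝ] ℝ) (b : W →L[ℝ] ℝ)
    (P : (W →L[ℝ] ℝ) →L[ℝ] (W →L[ℝ] ℝ) →L[ℝ] ℝ) (e : W) :
    ((W →L[ℝ] ℝ) × ℝ) →L[ℝ] (W →L[ℝ] ℝ) × ℝ :=
  ContinuousLinearMap.id ℝ _ + pairFlat θ b ∘L pairSharp P e

/-- `(P, e)♯ ∘ (Id + (θ, b)~ ∘ (P, e)♯)⁻¹`. -/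
def gaugedSharp (θ : W →L[ℝ] W →L[ℝ] ℝ) (b : W →L[ℝ] ℝ)
    (P : (W →L[ℝ] ℝ) →L[ℝ] (W →L[ℝ] ℝ) →L[ℝ] ℝ) (e : W) :
    ((W →L[ℝ] ℝ) × ℝ) →L[ℝ] W × ℝ :=
  pairSharp P e ∘L (gaugeEndo θ b P e).inverse

/-- The bivector part of `gaugedSharp`, `(α, β) ↦ β (pr₁ (gaugedSharp (α, 0)))`. -/
def gaugedBivector (θ : W →L[ℝ] W →L[ℝ] ℝ) (b : W →L[ℝ] ℝ)
    (P : (W →L[ℝ] ℝ) →L[ℝ] (W →L[ℝ] ℝ) →L[ℝ] ℝ) (e : W) :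
    (W →L[ℝ] ℝ) →L[ℝ] (W →L[ℝ] ℝ) →L[ℝ] ℝ :=
  NormedSpace.inclusionInDoubleDual ℝ W ∘L ContinuousLinearMap.fst ℝ W ℝ ∘L
    gaugedSharp θ b P e ∘L ContinuousLinearMap.inl ℝ (W →L[ℝ] ℝ) ℝ

/-- The vector part of `gaugedSharp`, `pr₁ (gaugedSharp (0, 1))`. -/
def gaugedVector (θ : W →L[ℝ] W →L[ℝ] ℝ) (b : W →L[ℝ] ℝ)
    (P : (W →L[ℝ] ℝ) →L[ℝ] (W →L[ℝ] ℝ) →L[ℝ] ℝ) (e : W) : W :=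
  (gaugedSharp θ b P e (0, 1)).1

/-- `♭ : X ↦ i_X θ + η(X) η`. -/
def contactFlat (θ : W →L[ℝ] W →L[ℝ] ℝ) (η : W →L[ℝ] ℝ) : W →L[ℝ] W →L[ℝ] ℝ :=
  θ + η.smulRight η

/-- `(α, β) ↦ θ (♭⁻¹ α, ♭⁻¹ β)`. -/
def contactBivectorAt (θ : W →L[ℝ] W →L[ℝ] ℝ) (η : W →L[ℝ] ℝ) :
    (W →L[ℝ] ℝ) →L[ℝ] (W →L[ℝ] ℝ) →L[ℝ] ℝ :=
  θ.bilinearComp (contactFlat θ η).inverse (contactFlat θ η).inverse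

/-- `♭⁻¹ η`. -/
def contactVectorAt (θ : W →L[ℝ] W →L[ℝ] ℝ) (η : W →L[ℝ] ℝ) : W :=
  (contactFlat θ η).inverse η

/-- The value `(η ∧ θⁿ)(v₀, …, v₂ₙ)` of the wedge product of a 1-form `η` with the `n`-th wedge
power of a 2-form `θ`. -/
def wedgePowEval (n : ℕ) (η : W →L[ℝ] ℝ) (θ : W →L[ℝ] W →L[ℝ] ℝ) (v : Fin (2 * n + 1) → W) : ℝ :=
  (1 / 2 ^ n : ℝ) * ∑ σ : Equiv.Perm (Fin (2 * n + 1)), ((Equiv.Perm.sign σ : ℤ) : ℝ) *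
    (η (v (σ 0)) * ∏ i : Fin n,
      θ (v (σ ⟨2 * (i : ℕ) + 1, by omega⟩)) (v (σ ⟨2 * (i : ℕ) + 2, by omega⟩)))

variable [FiniteDimensional ℝ W]

theorem inclusionInDoubleDual_isInvertible :
    (NormedSpace.inclusionInDoubleDual ℝ W).IsInvertible := by
  have hinj : Function.Injective (NormedSpace.inclusionInDoubleDual ℝ W) :=
    (NormedSpace.inclusionInDoubleDualLi (E := W) ℝ).injective
  have hfr : Module.finrank ℝ W = Module.finrank ℝ (StrongDual ℝ (StrongDual ℝ W)) := by
    have h : ∀ (U : Type _) [NormedAddCommGroup U] [NormedSpace ℝ U] [FiniteDimensional ℝ U],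
        Module.finrank ℝ (StrongDual ℝ U) = Module.finrank ℝ U := by
      intro U _ _ _
      rw [← (LinearMap.toContinuousLinearMap (𝕜 := ℝ) (E := U) (F' := ℝ)).finrank_eq]
      exact Subspace.dual_finrank_eq
    rw [h, h]
  let e := LinearEquiv.ofInjectiveOfFinrankEq
    (NormedSpace.inclusionInDoubleDual ℝ W).toLinearMap hinj hfr
  exact ⟨e.toContinuousLinearEquiv, by ext; rfl⟩

theorem apply_sharp (P : (W →L[ℝ] ℝ) →L[ℝ] (W →L[ℝ] ℝ) →L[ℝ] ℝ) (α β : W →L[ℝ] ℝ) :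
    β (sharp P α) = P α β := by
  obtain ⟨e, he⟩ := inclusionInDoubleDual_isInvertible (W := W)
  have h : NormedSpace.inclusionInDoubleDual ℝ W (sharp P α) = P α := by
    simp [sharp, ← he]
  rw [← h]; rfl

/-- The pair read off from `gaugedSharp` has `gaugedSharp` as its sharp map. -/
theorem pairSharp_gauged {θ : W →L[ℝ] W →L[ℝ] ℝ} {b : W →L[ℝ] ℝ}
    {P : (W →L[ℝ] ℝ) →L[ℝ] (W →L[ℝ] ℝ) →L[ℝ] ℝ} {e : W}
    (hθ : ∀ v w, θ v w = -θ w v) (hP : ∀ α β, P α β = -P β α)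
    (hΦ : Function.Bijective (gaugeEndo θ b P e)) :
    pairSharp (gaugedBivector θ b P e) (gaugedVector θ b P e) = gaugedSharp θ b P e := by
  have hinv : (gaugeEndo θ b P e).IsInvertible :=
    ⟨(LinearEquiv.ofBijective (gaugeEndo θ b P e).toLinearMap hΦ).toContinuousLinearEquiv,
      by ext <;> rfl⟩
  have hsk : ∀ u v : (W →L[ℝ] ℝ) × ℝ,
      u.1 (gaugedSharp θ b P e v).1 + u.2 * (gaugedSharp θ b P e v).2 =
        -(v.1 (gaugedSharp θ b P e u).1 + v.2 * (gaugedSharp θ b P e u).2) := by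
    intro u v
    obtain ⟨u, rfl⟩ := hΦ.2 u
    obtain ⟨v, rfl⟩ := hΦ.2 v
    have hS : ∀ w, gaugedSharp θ b P e (gaugeEndo θ b P e w) = pairSharp P e w := by
      intro w
      simp [gaugedSharp, hinv.inverse_apply_eq.2 (rfl : gaugeEndo θ b P e w = _)]
    rw [hS, hS]
    have h1 := hθ (pairSharp P e u).1 (pairSharp P e v).1
    have h2 := hP u.1 v.1
    simp [gaugeEndo, pairFlat, pairSharp, apply_sharp] at h1 ⊢
    linear_combination h1 + h2
  have hadd : ∀ (α : W →L[ℝ] ℝ) (g : ℝ), gaugedSharp θ b P e (α, g) =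
      gaugedSharp θ b P e (α, 0) + g • gaugedSharp θ b P e (0, 1) := by
    intro α g
    rw [← map_smul, ← map_add]
    simp
  have hsep : ∀ x y : W, (∀ β : W →L[ℝ] ℝ, β x = β y) → x = y := by
    intro x y h
    apply (NormedSpace.inclusionInDoubleDualLi (E := W) ℝ).injective
    ext β
    exact h β
  apply ContinuousLinearMap.ext
  rintro ⟨α, g⟩
  rw [hadd]
  apply Prod.ext
  · apply hsep
    intro β
    simp [pairSharp, apply_sharp, gaugedBivector, gaugedVector]
  · have h1 := hsk (α, 0) (0, 1)
    have h2 := hsk (0, 1) (0, 1)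
    simp at h1 h2
    simp [pairSharp, gaugedVector]
    have h3 : (gaugedSharp θ b P e (0, 1)).2 = 0 := by linarith
    rw [h3]
    linarith

end LinearAlgebra

/-! ### Tensor fields on a manifold modelled on a finite-dimensional space -/

section Manifold

variable {V : Type*} [NormedAddCommGroup V] [NormedSpace ℝ V]
  {M : Type*} [TopologicalSpace M] [ChartedSpace V M]

variable (V M) in
/-- A field of covectors on `M`. -/
abbrev CovectorField : Type _ :=
  ∀ x : M, TangentSpace 𝓘(ℝ, V) x →L[ℝ] ℝ

variable (V M) in
/-- A field of tangent vectors on `M`. -/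
abbrev TangentField : Type _ :=
  ∀ x : M, TangentSpace 𝓘(ℝ, V) x

variable (V M) in
/-- A field of bilinear forms on the cotangent spaces of `M`. -/
abbrev BicontravariantField : Type _ :=
  ∀ x : M, (TangentSpace 𝓘(ℝ, V) x →L[ℝ] ℝ) →L[ℝ] (TangentSpace 𝓘(ℝ, V) x →L[ℝ] ℝ) →L[ℝ] ℝ

/-- `η ∈ Ω¹(M)`: a smooth section of the cotangent bundle. -/
def IsOneForm [IsManifold 𝓘(ℝ, V) ∞ M] (η : CovectorField V M) : Prop :=
  ContMDiff 𝓘(ℝ, V) (𝓘(ℝ, V).prod 𝓘(ℝ, V →L[ℝ] ℝ)) ∞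
    (fun x : M ↦ Bundle.TotalSpace.mk' (V →L[ℝ] ℝ)
      (E := fun x : M ↦ TangentSpace 𝓘(ℝ, V) x →L[ℝ] ℝ) x (η x))

/-- A smooth vector field. -/
def IsVectorField [IsManifold 𝓘(ℝ, V) ∞ M] (E : TangentField V M) : Prop :=
  ContMDiff 𝓘(ℝ, V) 𝓘(ℝ, V).tangent ∞ (fun x : M ↦ (⟨x, E x⟩ : TangentBundle 𝓘(ℝ, V) M))

/-- A bivector field: a smooth skew-symmetric form on the cotangent bundle. -/
structure IsBivectorField [IsManifold 𝓘(ℝ, V) ∞ M] (π : BicontravariantField V M) : Prop where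
  smooth : ContMDiff 𝓘(ℝ, V)
    (𝓘(ℝ, V).prod 𝓘(ℝ, (V →L[ℝ] ℝ) →L[ℝ] (V →L[ℝ] ℝ) →L[ℝ] ℝ)) ∞
    (fun x : M ↦ Bundle.TotalSpace.mk' ((V →L[ℝ] ℝ) →L[ℝ] (V →L[ℝ] ℝ) →L[ℝ] ℝ)
      (E := fun x : M ↦ (TangentSpace 𝓘(ℝ, V) x →L[ℝ] ℝ) →L[ℝ]
        (TangentSpace 𝓘(ℝ, V) x →L[ℝ] ℝ) →L[ℝ] ℝ) x (π x))
  skew : ∀ x α β, π x α β = -π x β α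

/-- The 1-form `ψ^* η` on the chart domain in `V`, where `ψ` is the inverse of the preferred chart
at `x`. -/
def chartRep (η : CovectorField V M) (x : M) (y : V) : V →L[ℝ] ℝ :=
  η ((extChartAt 𝓘(ℝ, V) x).symm y) ∘L
    (mfderiv 𝓘(ℝ, V) 𝓘(ℝ, V) (extChartAt 𝓘(ℝ, V) x).symm y)

/-- The de Rham differential `dη` of a 1-form, computed in the preferred chart at each point, where
`dξ (v, w) = D_v (ξ(w)) - D_w (ξ(v))` for constant `v`, `w`. -/
def extDerivOne (η : CovectorField V M) (x : M) :
    TangentSpace 𝓘(ℝ, V) x →L[ℝ] TangentSpace 𝓘(ℝ, V) x →L[ℝ] ℝ :=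
  let D : V →L[ℝ] V →L[ℝ] ℝ := fderiv ℝ (chartRep η x) (extChartAt 𝓘(ℝ, V) x x)
  let A : V →L[ℝ] V := mfderiv 𝓘(ℝ, V) 𝓘(ℝ, V) (extChartAt 𝓘(ℝ, V) x) x
  show V →L[ℝ] V →L[ℝ] ℝ from (D - D.flip).bilinearComp A A

/-! ### Jacobi structures -/

/-- The function `π(df, dg)`. -/
def bivectorBracket (π : BicontravariantField V M) (f g : M → ℝ) (x : M) : ℝ :=
  π x (mvfderiv 𝓘(ℝ, V) f x) (mvfderiv 𝓘(ℝ, V) g x)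

/-- The function `E(f) = df(E)`. -/
def derivAlong (E : TangentField V M) (f : M → ℝ) (x : M) : ℝ :=
  mvfderiv 𝓘(ℝ, V) f x (E x)

/-- The value `[π, π](df, dg, dh)` of the Schouten bracket, with the sign for which
`[X ∧ Y, X ∧ Y] = -2 [X, Y] ∧ X ∧ Y`: twice the cyclic sum of `{{f, g}, h}`, `{f, g} = π(df, dg)`. -/
def schoutenSelf (π : BicontravariantField V M) (f g h : M → ℝ) (x : M) : ℝ :=
  2 * (bivectorBracket π (bivectorBracket π f g) h x
    + bivectorBracket π (bivectorBracket π g h) f x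
    + bivectorBracket π (bivectorBracket π h f) g x)

/-- The value `[E, π](df, dg)` of the Schouten bracket, that is, of the Lie derivative of `π`
along `E`. -/
def schoutenVectorBivector (E : TangentField V M) (π : BicontravariantField V M)
    (f g : M → ℝ) (x : M) : ℝ :=
  derivAlong E (bivectorBracket π f g) x - bivectorBracket π (derivAlong E f) g x
    - bivectorBracket π f (derivAlong E g) x

/-- The value `(E ∧ π)(df, dg, dh)`. -/
def wedgeVectorBivector (E : TangentField V M) (π : BicontravariantField V M)
    (f g h : M → ℝ) (x : M) : ℝ :=
  derivAlong E f x * bivectorBracket π g h x + derivAlong E g x * bivectorBracket π h f x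
    + derivAlong E h x * bivectorBracket π f g x

/-- `(π, E)` is a Jacobi structure: `[π, π] = 2 E ∧ π` and `[E, π] = 0`. A multivector is determined
by its values on differentials at `x` of functions that are smooth at `x`. -/
structure IsJacobiStructure [IsManifold 𝓘(ℝ, V) ∞ M]
    (π : BicontravariantField V M) (E : TangentField V M) : Prop where
  bivector : IsBivectorField π
  vector : IsVectorField E
  schouten_self : ∀ (x : M) (f g h : M → ℝ), ContMDiffAt 𝓘(ℝ, V) 𝓘(ℝ, ℝ) ∞ f x →
    ContMDiffAt 𝓘(ℝ, V) 𝓘(ℝ, ℝ) ∞ g x → ContMDiffAt 𝓘(ℝ, V) 𝓘(ℝ, ℝ) ∞ h x →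
    schoutenSelf π f g h x = 2 * wedgeVectorBivector E π f g h x
  schouten_vector : ∀ (x : M) (f g : M → ℝ), ContMDiffAt 𝓘(ℝ, V) 𝓘(ℝ, ℝ) ∞ f x →
    ContMDiffAt 𝓘(ℝ, V) 𝓘(ℝ, ℝ) ∞ g x → schoutenVectorBivector E π f g x = 0

/-- The smooth map `φ` preserves the bivector fields and the vector fields: `φ_* π' = π` and
`φ_* E' = E`, at every point of the source. Between Jacobi manifolds this says that `φ` is a Jacobi
map. -/
structure IsJacobiMap {V' : Type*} [NormedAddCommGroup V'] [NormedSpace ℝ V']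
    {M' : Type*} [TopologicalSpace M'] [ChartedSpace V' M'] (φ : M' → M)
    (π' : BicontravariantField V' M') (E' : TangentField V' M')
    (π : BicontravariantField V M) (E : TangentField V M) : Prop where
  smooth : ContMDiff 𝓘(ℝ, V') 𝓘(ℝ, V) ∞ φ
  map_bivector : ∀ (x : M') (α β : TangentSpace 𝓘(ℝ, V) (φ x) →L[ℝ] ℝ),
    π' x (α ∘L mfderiv 𝓘(ℝ, V') 𝓘(ℝ, V) φ x) (β ∘L mfderiv 𝓘(ℝ, V') 𝓘(ℝ, V) φ x) =
      π (φ x) α β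
  map_vector : ∀ x : M', mfderiv 𝓘(ℝ, V') 𝓘(ℝ, V) φ x (E' x) = E (φ x)

/-- The pullback `φ^* B` of a 1-form. -/
def pullbackOne {V' : Type*} [NormedAddCommGroup V'] [NormedSpace ℝ V']
    {M' : Type*} [TopologicalSpace M'] [ChartedSpace V' M'] (φ : M' → M)
    (B : CovectorField V M) : CovectorField V' M' :=
  fun x ↦ B (φ x) ∘L mfderiv 𝓘(ℝ, V') 𝓘(ℝ, V) φ x

/-! ### Contact forms -/

/-- `η` is a contact form: a 1-form on a manifold of dimension `2n + 1` such that `η ∧ (dη)ⁿ` is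
nonzero at every point. -/
structure IsContactForm [IsManifold 𝓘(ℝ, V) ∞ M] (η : CovectorField V M) : Prop where
  oneForm : IsOneForm η
  nondegenerate : ∃ n : ℕ, Module.finrank ℝ V = 2 * n + 1 ∧ ∀ x : M, ∃ v : Fin (2 * n + 1) → V,
    wedgePowEval (W := V) n (η x) (extDerivOne η x) v ≠ 0

/-- The bivector field `π(α, β) = dη (♭⁻¹ α, ♭⁻¹ β)` of a contact form, where
`♭ X = i_X dη + η(X) η`. -/
def contactBivector (η : CovectorField V M) : BicontravariantField V M :=
  fun x ↦ contactBivectorAt (W := V) (extDerivOne η x) (η x)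

/-- The vector field `E = ♭⁻¹ η` of a contact form. -/
def contactVector (η : CovectorField V M) : TangentField V M :=
  fun x ↦ contactVectorAt (W := V) (extDerivOne η x) (η x)

/-! ### Gauge transformations -/

/-- The 1-form `B` is `(π, E)`-admissible: `Id + (dB, B)~ ∘ (π, E)♯` is invertible on every
`T_x^* M × ℝ`. -/
def IsAdmissible (π : BicontravariantField V M) (E : TangentField V M)
    (B : CovectorField V M) : Prop :=
  ∀ x : M, Function.Bijective (gaugeEndo (W := V) (extDerivOne B x) (B x) (π x) (E x))

/-- The bivector field `π_B` of the gauge transformation `τ_B (π, E) = (π_B, E_B)`, which is given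
by `(π_B, E_B)♯ = (π, E)♯ ∘ (Id + (dB, B)~ ∘ (π, E)♯)⁻¹`. -/
def gaugeBivector (B : CovectorField V M) (π : BicontravariantField V M) (E : TangentField V M) :
    BicontravariantField V M :=
  fun x ↦ gaugedBivector (W := V) (extDerivOne B x) (B x) (π x) (E x)

/-- The vector field `E_B` of the gauge transformation `τ_B (π, E) = (π_B, E_B)`. -/
def gaugeVector (B : CovectorField V M) (π : BicontravariantField V M) (E : TangentField V M) :
    TangentField V M :=
  fun x ↦ gaugedVector (W := V) (extDerivOne B x) (B x) (π x) (E x)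

end Manifold

end JacobiGeometry

end

/-! A pair `(θ, η)` of a 2-form and a 1-form is encoded as the skew map `Ω = pairFlat θ η` from `W ×
ℝ` to `W* × ℝ`, and a pair `(P, e)` as the skew map `S = pairSharp P e` in the opposite direction.
The form `η` is contact exactly when `Ω_η = pairFlat (dη) η` is invertible and the dimension is odd,
and then its Jacobi structure is `S_η = -Ω_η⁻¹` (`pairFlat_contact`). The gauge transformation is
`S_B = S (Id + Ω_B S)⁻¹`, formally `S_B⁻¹ = S⁻¹ + Ω_B`. Hence replacing `Ω_η` by `Ω_η - F^*Ω_B`,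
with `F` the differential of `φ`, replaces `-Ω_η⁻¹` by a structure that `F` maps to `S_B`.

At a point this is linear algebra. A Jacobi map satisfies `F S_η F^* = S`. If `Ω_η u = F^*Ω_B F u`,
put `y = -Ω_B F u`; then `u = S_η F^* y`, so `(Id + Ω_B S) y = 0` and admissibility gives `u = 0`
(`pairFlat_sub_pullback_injective`). The same computation with a right-hand side gives the Jacobi
map property (`pairPush_contact_sub_pullback`). Since `d` commutes with pullback, `η - φ^*B` has the
pair `Ω_η - F^*Ω_B`.

The Jacobi identities are those of the homogeneous Poisson bivector `e^{-t}(π + ∂_t ∧ E)` on `M ×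
ℝ`: `poissonDefect` is its Jacobiator with the factor in `t` removed, and `closedDefect` is likewise
the differential of `e^t(dB + dt ∧ B) = d(e^t B)`, which vanishes. Differentiating `Ω S = -Id`,
respectively `S' (Id + Ω S) = S`, expresses the Jacobiator of the new structure through that of the
old one and `closedDefect` (`poissonDefect_of_inverse`, `poissonDefect_of_gauge`). Charts transport
this to manifolds (`isJacobiStructure_iff`).

The nonvanishing of `η ∧ (dη)ⁿ` is translated to and from injectivity of `Ω_η` by
`pairFlat_injective_of_wedgePowEval` and `exists_wedgePowEval_ne_zero`. -/

noncomputable section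

namespace JacobiGeometry

/-! ### Linear algebra of the maps `pairFlat` and `pairSharp` at one point. -/

section PairAlgebra

variable {W : Type*} [NormedAddCommGroup W] [NormedSpace ℝ W]
  {V : Type*} [NormedAddCommGroup V] [NormedSpace ℝ V]

/-- The pairing between `W* × ℝ` and `W × ℝ`. -/
def dualPairing (a : (W →L[ℝ] ℝ) × ℝ) (u : W × ℝ) : ℝ := a.1 u.1 + a.2 * u.2

theorem dualPairing_add_left (a b : (W →L[ℝ] ℝ) × ℝ) (u : W × ℝ) :
    dualPairing (a + b) u = dualPairing a u + dualPairing b u := by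
  simp [dualPairing]; ring

theorem dualPairing_add_right (a : (W →L[ℝ] ℝ) × ℝ) (u v : W × ℝ) :
    dualPairing a (u + v) = dualPairing a u + dualPairing a v := by
  simp [dualPairing]; ring

theorem dualPairing_sub_right (a : (W →L[ℝ] ℝ) × ℝ) (u v : W × ℝ) :
    dualPairing a (u - v) = dualPairing a u - dualPairing a v := by
  simp [dualPairing]; ring

theorem dualPairing_neg_left (a : (W →L[ℝ] ℝ) × ℝ) (u : W × ℝ) :
    dualPairing (-a) u = -dualPairing a u := by
  simp [dualPairing]; ring

theorem eq_of_forall_dual {x y : W} (h : ∀ β : W →L[ℝ] ℝ, β x = β y) : x = y := by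
  apply (NormedSpace.inclusionInDoubleDualLi (E := W) ℝ).injective
  ext β
  exact h β

theorem dualPairing_ext {u v : W × ℝ} (h : ∀ a, dualPairing a u = dualPairing a v) : u = v := by
  apply Prod.ext
  · exact eq_of_forall_dual fun β ↦ by simpa [dualPairing] using h (β, 0)
  · simpa [dualPairing] using h (0, 1)

/-- The map `(α, g) ↦ (F^* α, g)`. -/
def pairPullback (F : W →L[ℝ] V) (a : (V →L[ℝ] ℝ) × ℝ) : (W →L[ℝ] ℝ) × ℝ := (a.1 ∘L F, a.2)

/-- The map `(X, f) ↦ (F X, f)`. -/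
def pairPush (F : W →L[ℝ] V) (u : W × ℝ) : V × ℝ := (F u.1, u.2)

theorem dualPairing_pairPullback (F : W →L[ℝ] V) (a : (V →L[ℝ] ℝ) × ℝ) (u : W × ℝ) :
    dualPairing (pairPullback F a) u = dualPairing a (pairPush F u) := by
  simp [dualPairing, pairPullback, pairPush]

theorem pairPush_pairFlat_pullback (F : W →L[ℝ] V) (θ : V →L[ℝ] V →L[ℝ] ℝ) (b : V →L[ℝ] ℝ)
    (u : W × ℝ) :
    pairFlat (θ.bilinearComp F F) (b ∘L F) u = pairPullback F (pairFlat θ b (pairPush F u)) := by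
  apply Prod.ext
  · ext; simp [pairFlat, pairPullback, pairPush]
  · simp [pairFlat, pairPullback, pairPush]

theorem dualPairing_pairFlat (θ : W →L[ℝ] W →L[ℝ] ℝ) (b : W →L[ℝ] ℝ) (u v : W × ℝ) :
    dualPairing (pairFlat θ b u) v = θ u.1 v.1 + u.2 * b v.1 - v.2 * b u.1 := by
  simp [dualPairing, pairFlat]; ring

theorem pairFlat_sub (θ θ' : W →L[ℝ] W →L[ℝ] ℝ) (b b' : W →L[ℝ] ℝ) (u : W × ℝ) :
    pairFlat (θ - θ') (b - b') u = pairFlat θ b u - pairFlat θ' b' u := by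
  apply Prod.ext
  · ext; simp [pairFlat]; ring
  · simp [pairFlat]; ring

/-- Evaluating `♭ X = 0` on `X` itself leaves `η(X)² = 0`, since `θ` is skew. -/
theorem contactFlat_ker {θ : W →L[ℝ] W →L[ℝ] ℝ} {η : W →L[ℝ] ℝ} (hθ : ∀ v w, θ v w = -θ w v)
    {X : W} (hX : contactFlat θ η X = 0) : θ X = 0 ∧ η X = 0 := by
  have h1 : θ X + η X • η = 0 := by simpa [contactFlat] using hX
  have h3 : θ X X = 0 := by linarith [hθ X X]
  have h4 : η X = 0 := by
    have := DFunLike.congr_fun h1 X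
    simpa [h3] using this
  exact ⟨by simpa [h4] using h1, h4⟩

theorem contactBivectorAt_skew {θ : W →L[ℝ] W →L[ℝ] ℝ} (η : W →L[ℝ] ℝ)
    (hθ : ∀ v w, θ v w = -θ w v) (α β : W →L[ℝ] ℝ) :
    contactBivectorAt θ η α β = -contactBivectorAt θ η β α := by
  simpa [contactBivectorAt] using hθ _ _

theorem pairFlat_skew {θ : W →L[ℝ] W →L[ℝ] ℝ} (b : W →L[ℝ] ℝ)
    (hθ : ∀ v w, θ v w = -θ w v) (u v : W × ℝ) :
    dualPairing (pairFlat θ b u) v = -dualPairing (pairFlat θ b v) u := by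
  rw [dualPairing_pairFlat, dualPairing_pairFlat, hθ]; ring

theorem gaugeEndo_apply (θ : W →L[ℝ] W →L[ℝ] ℝ) (b : W →L[ℝ] ℝ)
    (P : (W →L[ℝ] ℝ) →L[ℝ] (W →L[ℝ] ℝ) →L[ℝ] ℝ) (e : W) (a : (W →L[ℝ] ℝ) × ℝ) :
    gaugeEndo θ b P e a = a + pairFlat θ b (pairSharp P e a) := rfl

variable [FiniteDimensional ℝ W] [FiniteDimensional ℝ V]

theorem dualPairing_pairSharp (P : (W →L[ℝ] ℝ) →L[ℝ] (W →L[ℝ] ℝ) →L[ℝ] ℝ) (e : W)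
    (a b : (W →L[ℝ] ℝ) × ℝ) :
    dualPairing b (pairSharp P e a) = P a.1 b.1 + a.2 * b.1 e - b.2 * a.1 e := by
  simp [dualPairing, pairSharp, apply_sharp]; ring

theorem finrank_dual_prod_eq : Module.finrank ℝ ((W →L[ℝ] ℝ) × ℝ) = Module.finrank ℝ (W × ℝ) := by
  rw [Module.finrank_prod, Module.finrank_prod,
    ← (LinearMap.toContinuousLinearMap (𝕜 := ℝ) (E := W) (F' := ℝ)).finrank_eq]
  congr 1
  exact Subspace.dual_finrank_eq

theorem pairFlat_bijective {θ : W →L[ℝ] W →L[ℝ] ℝ} {b : W →L[ℝ] ℝ}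
    (h : Function.Injective (pairFlat θ b)) : Function.Bijective (pairFlat θ b) :=
  ⟨h, ((pairFlat θ b).toLinearMap.injective_iff_surjective_of_finrank_eq_finrank
    finrank_dual_prod_eq.symm).1 h⟩

theorem contactFlat_bijective_of_injective {θ : W →L[ℝ] W →L[ℝ] ℝ} {η : W →L[ℝ] ℝ}
    (h : Function.Injective (contactFlat θ η)) : Function.Bijective (contactFlat θ η) := by
  refine ⟨h, ((contactFlat θ η).toLinearMap.injective_iff_surjective_of_finrank_eq_finrank ?_).1 h⟩
  rw [← (LinearMap.toContinuousLinearMap (𝕜 := ℝ) (E := W) (F' := ℝ)).finrank_eq]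
  exact Subspace.dual_finrank_eq.symm

theorem isInvertible_of_bijective {U U' : Type*} [NormedAddCommGroup U] [NormedSpace ℝ U]
    [NormedAddCommGroup U'] [NormedSpace ℝ U'] [FiniteDimensional ℝ U] {A : U →L[ℝ] U'}
    (h : Function.Bijective A) : A.IsInvertible :=
  ⟨(LinearEquiv.ofBijective A.toLinearMap h).toContinuousLinearEquiv, by ext; rfl⟩

/-- Existence of the Reeb vector. Injectivity gives surjectivity by equality of dimensions, and `E`
is the vector part of a preimage of `(0, -1)`; evaluating the first component on `E` kills the
scalar part. -/
theorem exists_reeb {θ : W →L[ℝ] W →L[ℝ] ℝ} {η : W →L[ℝ] ℝ} (hθ : ∀ v w, θ v w = -θ w v)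
    (h : Function.Injective (pairFlat θ η)) : ∃ E, θ E = 0 ∧ η E = 1 := by
  obtain ⟨⟨E, f⟩, hE⟩ := (pairFlat_bijective h).2 (0, -1)
  have h1 : θ E + f • η = 0 := by simpa [pairFlat] using congrArg Prod.fst hE
  have h2 : η E = 1 := by simpa [pairFlat] using congrArg Prod.snd hE
  have h3 : θ E E = 0 := by linarith [hθ E E]
  have h4 : f = 0 := by
    have := DFunLike.congr_fun h1 E
    simpa [h3, h2] using this
  exact ⟨E, by simpa [h4] using h1, h2⟩

theorem contactFlat_bijective {θ : W →L[ℝ] W →L[ℝ] ℝ} {η : W →L[ℝ] ℝ}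
    (hθ : ∀ v w, θ v w = -θ w v) (h : Function.Injective (pairFlat θ η)) :
    Function.Bijective (contactFlat θ η) := by
  apply contactFlat_bijective_of_injective
  refine (injective_iff_map_eq_zero _).2 fun X hX ↦ ?_
  obtain ⟨h1, h2⟩ := contactFlat_ker hθ hX
  have : pairFlat θ η (X, 0) = 0 := by simp [pairFlat, h1, h2]
  exact congrArg Prod.fst ((injective_iff_map_eq_zero _).1 h _ this)

/-- For `α = ♭ X` and the Reeb vector `E`, the vector `π♯ α` is `-X + η(X) E`; substituting this
gives the identity. The minus sign is the reason why a gauge transformation by `B` corresponds to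
subtracting the pullback of `B` from `η`. -/
theorem pairFlat_contact {θ : W →L[ℝ] W →L[ℝ] ℝ} {η : W →L[ℝ] ℝ}
    (hθ : ∀ v w, θ v w = -θ w v) (h : Function.Injective (pairFlat θ η))
    (a : (W →L[ℝ] ℝ) × ℝ) :
    pairFlat θ η (pairSharp (contactBivectorAt θ η) (contactVectorAt θ η) a) = -a := by
  obtain ⟨E, hE1, hE2⟩ := exists_reeb hθ h
  have hinv := isInvertible_of_bijective (contactFlat_bijective hθ h)
  have hE : contactVectorAt θ η = E := by
    refine hinv.inverse_apply_eq.2 ?_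
    simp [contactFlat, hE1, hE2]
  have hXE : ∀ X, θ X E = 0 := fun X ↦ by rw [hθ, hE1]; simp
  obtain ⟨α, g⟩ := a
  obtain ⟨X, rfl⟩ := (contactFlat_bijective hθ h).2 α
  have hX : (contactFlat θ η).inverse (contactFlat θ η X) = X :=
    hinv.inverse_apply_eq.2 rfl
  have hsharp : sharp (contactBivectorAt θ η) (contactFlat θ η X) = -X + η X • E := by
    refine eq_of_forall_dual fun β ↦ ?_
    rw [apply_sharp]
    obtain ⟨Y, rfl⟩ := (contactFlat_bijective hθ h).2 β
    have hY : (contactFlat θ η).inverse (contactFlat θ η Y) = Y :=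
      hinv.inverse_apply_eq.2 rfl
    have hP : contactBivectorAt θ η (contactFlat θ η X) (contactFlat θ η Y) = θ X Y := by
      rw [contactBivectorAt, ContinuousLinearMap.bilinearComp_apply, hX, hY]
    rw [hP]
    simp [contactFlat, hXE, hE2, hθ Y X]
  apply Prod.ext
  · simp [pairFlat, pairSharp, hsharp, hE, hE1]
    ext; simp [contactFlat, hXE, hE2]; ring
  · simp [pairFlat, pairSharp, hsharp, hE, hE2]

theorem pairSharp_skew {P : (W →L[ℝ] ℝ) →L[ℝ] (W →L[ℝ] ℝ) →L[ℝ] ℝ} (e : W)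
    (hP : ∀ α β, P α β = -P β α) (a b : (W →L[ℝ] ℝ) × ℝ) :
    dualPairing b (pairSharp P e a) = -dualPairing a (pairSharp P e b) := by
  rw [dualPairing_pairSharp, dualPairing_pairSharp, hP]; ring

/-- The defining relation `S_B (Id + Ω S) = S` with the inverse cleared, the form in which the gauge
transformation is used below. -/
theorem pairSharp_gauged_gaugeEndo {θ : W →L[ℝ] W →L[ℝ] ℝ} {b : W →L[ℝ] ℝ}
    {P : (W →L[ℝ] ℝ) →L[ℝ] (W →L[ℝ] ℝ) →L[ℝ] ℝ} {e : W}
    (hθ : ∀ v w, θ v w = -θ w v) (hP : ∀ α β, P α β = -P β α)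
    (hΦ : Function.Bijective (gaugeEndo θ b P e)) (a : (W →L[ℝ] ℝ) × ℝ) :
    pairSharp (gaugedBivector θ b P e) (gaugedVector θ b P e) (gaugeEndo θ b P e a) =
      pairSharp P e a := by
  rw [pairSharp_gauged hθ hP hΦ]
  simp [gaugedSharp, (isInvertible_of_bijective hΦ).inverse_apply_eq.2
    (rfl : gaugeEndo θ b P e a = _)]

/-- Every covector pair has the form `v + Ω S v`, and `⟨v + Ω S v, S u⟩` is the sum of the skew
forms `⟨v, S u⟩` and `⟨Ω S v, S u⟩`. -/
theorem gaugedBivector_skew {θ : W →L[ℝ] W →L[ℝ] ℝ} {b : W →L[ℝ] ℝ}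
    {P : (W →L[ℝ] ℝ) →L[ℝ] (W →L[ℝ] ℝ) →L[ℝ] ℝ} {e : W}
    (hθ : ∀ v w, θ v w = -θ w v) (hP : ∀ α β, P α β = -P β α)
    (hΦ : Function.Bijective (gaugeEndo θ b P e)) (α β : W →L[ℝ] ℝ) :
    gaugedBivector θ b P e α β = -gaugedBivector θ b P e β α := by
  suffices h : ∀ u v : (W →L[ℝ] ℝ) × ℝ,
      dualPairing v (pairSharp (gaugedBivector θ b P e) (gaugedVector θ b P e) u) =
        -dualPairing u (pairSharp (gaugedBivector θ b P e) (gaugedVector θ b P e) v) by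
    simpa [dualPairing_pairSharp] using h (α, 0) (β, 0)
  intro u v
  obtain ⟨u, rfl⟩ := hΦ.2 u
  obtain ⟨v, rfl⟩ := hΦ.2 v
  rw [pairSharp_gauged_gaugeEndo hθ hP hΦ, pairSharp_gauged_gaugeEndo hθ hP hΦ, gaugeEndo_apply,
    gaugeEndo_apply, dualPairing_add_left, dualPairing_add_left, pairSharp_skew e hP,
    pairFlat_skew b hθ]
  ring

section Map

variable {F : W →L[ℝ] V} {θ : W →L[ℝ] W →L[ℝ] ℝ} {η : W →L[ℝ] ℝ}
  {σ : V →L[ℝ] V →L[ℝ] ℝ} {b : V →L[ℝ] ℝ}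
  {P : (V →L[ℝ] ℝ) →L[ℝ] (V →L[ℝ] ℝ) →L[ℝ] ℝ} {e : V}
  {Q : (W →L[ℝ] ℝ) →L[ℝ] (W →L[ℝ] ℝ) →L[ℝ] ℝ} {z : W}

/-- The two conditions on a Jacobi map merge into the single equation `F S F^* = S`;
`map_contact_sub_pullback` is the converse. -/
theorem pairPush_pairSharp_pairPullback
    (hFP : ∀ α β, Q (α ∘L F) (β ∘L F) = P α β) (hFe : F z = e) (a : (V →L[ℝ] ℝ) × ℝ) :
    pairPush F (pairSharp Q z (pairPullback F a)) = pairSharp P e a := by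
  refine dualPairing_ext fun c ↦ ?_
  rw [← dualPairing_pairPullback, dualPairing_pairSharp, dualPairing_pairSharp]
  simp [pairPullback, hFP, hFe]

/-- If `(Q, z)` is minus the inverse of `(θ, η)` and `F` maps it to `(P, e)`, then
`(θ, η) - F^* (σ, b)` is nondegenerate as soon as `Id + (σ, b) ∘ (P, e)` is. -/
theorem pairFlat_sub_pullback_injective
    (hQ : ∀ a, pairFlat θ η (pairSharp Q z a) = -a) (hinj : Function.Injective (pairFlat θ η))
    (hFP : ∀ α β, Q (α ∘L F) (β ∘L F) = P α β) (hFe : F z = e)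
    (hΦ : Function.Bijective (gaugeEndo σ b P e)) :
    Function.Injective (pairFlat (θ - σ.bilinearComp F F) (η - b ∘L F)) := by
  refine (injective_iff_map_eq_zero _).2 fun u hu ↦ ?_
  -- The kernel equation says that `Ω_η u` is a pullback `-F^* y`, so `u = S F^* y`; pushing forward
  -- by `F` gives an equation for `y` alone, to which admissibility applies.
  rw [pairFlat_sub, pairPush_pairFlat_pullback, sub_eq_zero] at hu
  set y := -pairFlat σ b (pairPush F u) with hy
  have hneg : pairFlat θ η u = -pairPullback F y := by
    rw [hu, hy]
    apply Prod.ext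
    · ext; simp [pairPullback]
    · simp [pairPullback]
  have hu' : u = pairSharp Q z (pairPullback F y) := hinj (by rw [hneg, hQ])
  have hy0 : gaugeEndo σ b P e y = 0 := by
    rw [gaugeEndo_apply, ← pairPush_pairSharp_pairPullback hFP hFe, ← hu', hy]
    simp
  have : y = 0 := (injective_iff_map_eq_zero _).1 hΦ.1 y hy0
  rw [hu', this]
  have : pairPullback F (0 : (V →L[ℝ] ℝ) × ℝ) = 0 := by
    apply Prod.ext
    · ext; simp [pairPullback]
    · simp [pairPullback]
  rw [this, map_zero]

theorem pairPush_contact_sub_pullback {Q' : (W →L[ℝ] ℝ) →L[ℝ] (W →L[ℝ] ℝ) →L[ℝ] ℝ} {z' : W}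
    (hQ : ∀ a, pairFlat θ η (pairSharp Q z a) = -a)
    (hinj : Function.Injective (pairFlat (θ - σ.bilinearComp F F) (η - b ∘L F)))
    (hQ' : ∀ a, pairFlat (θ - σ.bilinearComp F F) (η - b ∘L F) (pairSharp Q' z' a) = -a)
    (hFP : ∀ α β, Q (α ∘L F) (β ∘L F) = P α β) (hFe : F z = e)
    (hσ : ∀ v w, σ v w = -σ w v) (hP : ∀ α β, P α β = -P β α)
    (hΦ : Function.Bijective (gaugeEndo σ b P e)) (a : (V →L[ℝ] ℝ) × ℝ) :
    pairPush F (pairSharp Q' z' (pairPullback F a)) =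
      pairSharp (gaugedBivector σ b P e) (gaugedVector σ b P e) a := by
  obtain ⟨a, rfl⟩ := hΦ.2 a
  rw [pairSharp_gauged_gaugeEndo hσ hP hΦ, ← pairPush_pairSharp_pairPullback hFP hFe]
  -- The equality already holds in the source, before `F` is applied: both vectors have the same
  -- image under the injective map `Ω_η - F^*Ω_B`.
  congr 1
  apply hinj
  rw [hQ', pairFlat_sub, hQ, pairPush_pairFlat_pullback, pairPush_pairSharp_pairPullback hFP hFe,
    gaugeEndo_apply]
  apply Prod.ext
  · ext; simp [pairPullback]; ring
  · simp [pairPullback]; ring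

theorem map_contact_sub_pullback {Q' : (W →L[ℝ] ℝ) →L[ℝ] (W →L[ℝ] ℝ) →L[ℝ] ℝ} {z' : W}
    (h : ∀ a, pairPush F (pairSharp Q' z' (pairPullback F a)) = pairSharp P e a) :
    (∀ α β, Q' (α ∘L F) (β ∘L F) = P α β) ∧ F z' = e := by
  constructor
  · intro α β
    have := congrArg (dualPairing (β, 0)) (h (α, 0))
    rw [← dualPairing_pairPullback, dualPairing_pairSharp, dualPairing_pairSharp] at this
    simpa [pairPullback] using this
  · have := congrArg Prod.fst (h (0, 1))
    simpa [pairSharp, pairPullback, pairPush] using this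

end Map

end PairAlgebra

/-! ### Exterior derivative, Jacobiator and closedness on a vector space. -/

section Flat

variable {V : Type*} [NormedAddCommGroup V] [NormedSpace ℝ V]

/-- The exterior derivative of a 1-form on a vector space. -/
def flatExtDeriv (b : V → V →L[ℝ] ℝ) (y : V) : V →L[ℝ] V →L[ℝ] ℝ :=
  fderiv ℝ b y - (fderiv ℝ b y).flip

theorem flatExtDeriv_skew (b : V → V →L[ℝ] ℝ) (y v w : V) :
    flatExtDeriv b y v w = -flatExtDeriv b y w v := by
  simp [flatExtDeriv]

/-- The exterior derivative commutes with pullback. -/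
theorem flatExtDeriv_pullback {W : Type*} [NormedAddCommGroup W] [NormedSpace ℝ W]
    {b : V → V →L[ℝ] ℝ} {ψ : W → V} {y : W} (hb : DifferentiableAt ℝ b (ψ y))
    (hψ : ContDiffAt ℝ 2 ψ y) :
    flatExtDeriv (fun z ↦ b (ψ z) ∘L fderiv ℝ ψ z) y =
      (flatExtDeriv b (ψ y)).bilinearComp (fderiv ℝ ψ y) (fderiv ℝ ψ y) := by
  have h1 : HasFDerivAt ψ (fderiv ℝ ψ y) y := (hψ.differentiableAt (by norm_num)).hasFDerivAt
  have h2 : HasFDerivAt (fderiv ℝ ψ) (fderiv ℝ (fderiv ℝ ψ) y) y :=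
    ((hψ.fderiv_right (m := 1) (by norm_num)).differentiableAt (by norm_num)).hasFDerivAt
  have h3 : HasFDerivAt (fun z ↦ b (ψ z)) (fderiv ℝ b (ψ y) ∘L fderiv ℝ ψ y) y :=
    hb.hasFDerivAt.comp y h1
  have h4 := (h3.clm_comp h2).fderiv
  -- The extra terms `b (D²ψ (v, w))` of the product rule cancel in the antisymmetrization.
  have hsymm := hψ.isSymmSndFDerivAt (by simp)
  ext v w
  simp only [flatExtDeriv, h4]
  simp [hsymm.eq v w]

/-- The cyclic sum of `⟨b, (∇_{S c} S) a⟩`, where `∇_(X, f) S = D_X S - f S`. -/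
def poissonDefect (S : V → ((V →L[ℝ] ℝ) × ℝ) →L[ℝ] V × ℝ) (y : V)
    (a b c : (V →L[ℝ] ℝ) × ℝ) : ℝ :=
  (dualPairing b (fderiv ℝ S y (S y c).1 a) - (S y c).2 * dualPairing b (S y a)) +
  (dualPairing c (fderiv ℝ S y (S y a).1 b) - (S y a).2 * dualPairing c (S y b)) +
  (dualPairing a (fderiv ℝ S y (S y b).1 c) - (S y b).2 * dualPairing a (S y c))

/-- The cyclic sum of `⟨(∇_u Ω) v, w⟩`, where `∇_(X, f) Ω = D_X Ω + f Ω`. -/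
def closedDefect (Ω : V → (V × ℝ) →L[ℝ] (V →L[ℝ] ℝ) × ℝ) (y : V) (u v w : V × ℝ) : ℝ :=
  (dualPairing (fderiv ℝ Ω y u.1 v) w + u.2 * dualPairing (Ω y v) w) +
  (dualPairing (fderiv ℝ Ω y v.1 w) u + v.2 * dualPairing (Ω y w) u) +
  (dualPairing (fderiv ℝ Ω y w.1 u) v + w.2 * dualPairing (Ω y u) v)

section Gauge

variable {S S' : V → ((V →L[ℝ] ℝ) × ℝ) →L[ℝ] V × ℝ} {Ω : V → (V × ℝ) →L[ℝ] (V →L[ℝ] ℝ) × ℝ} {y : V}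

/-- Differentiating `Ω S = -Id` turns each `⟨b, (∇S) a⟩` into `-⟨(∇Ω) S a, S b⟩`, the opposite
weights `-f` and `+f` of the two connections being compatible with this. So the defect at `(a, b,
c)` is minus `closedDefect` at `(S c, S a, S b)`. -/
theorem poissonDefect_of_inverse (hS : DifferentiableAt ℝ S y) (hΩ : DifferentiableAt ℝ Ω y)
    (hrel : ∀ᶠ z in nhds y, ∀ a, Ω z (S z a) = -a)
    (hΩskew : ∀ u v, dualPairing (Ω y u) v = -dualPairing (Ω y v) u)
    (hclosed : ∀ u v w, closedDefect Ω y u v w = 0) (a b c : (V →L[ℝ] ℝ) × ℝ) :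
    poissonDefect S y a b c = 0 := by
  have hrel' : (fun z ↦ Ω z ∘L S z) =ᶠ[nhds y] fun _ ↦ -ContinuousLinearMap.id ℝ _ := by
    filter_upwards [hrel] with z hz
    exact ContinuousLinearMap.ext fun a ↦ by simpa using hz a
  have hd := (hΩ.hasFDerivAt.clm_comp hS.hasFDerivAt).fderiv
  rw [hrel'.fderiv_eq, fderiv_const_apply] at hd
  have hD : ∀ X a, Ω y (fderiv ℝ S y X a) = -fderiv ℝ Ω y X (S y a) := by
    intro X a
    have := DFunLike.congr_fun (DFunLike.congr_fun hd X) a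
    simp at this
    exact eq_neg_of_add_eq_zero_left this.symm
  have hΩS := hrel.self_of_nhds
  have key : ∀ (X : V) (a b : (V →L[ℝ] ℝ) × ℝ),
      dualPairing b (fderiv ℝ S y X a) = -dualPairing (fderiv ℝ Ω y X (S y a)) (S y b) := by
    intro X a b
    have h1 := hΩskew (S y b) (fderiv ℝ S y X a)
    rw [hΩS, hD, dualPairing_neg_left, dualPairing_neg_left] at h1
    linarith
  have key2 : ∀ a b, dualPairing b (S y a) = -dualPairing (Ω y (S y b)) (S y a) := by
    intro a b
    rw [hΩS, dualPairing_neg_left, neg_neg]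
  have h := hclosed (S y c) (S y a) (S y b)
  unfold closedDefect at h
  unfold poissonDefect
  rw [key, key, key, key2 a b, key2 b c, key2 c a]
  rw [hΩskew (S y b) (S y a), hΩskew (S y c) (S y b), hΩskew (S y a) (S y c)]
  linarith

/-- With `a' = a + Ω S a`, and likewise `b'`, `c'`, the defect of `S'` at `(a', b', c')` is the
defect of `S` at `(a, b, c)` plus `closedDefect` at `(S c, S a, S b)`. -/
theorem poissonDefect_of_gauge (hS : DifferentiableAt ℝ S y) (hS' : DifferentiableAt ℝ S' y)
    (hΩ : DifferentiableAt ℝ Ω y)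
    (hrel : ∀ᶠ z in nhds y, ∀ a, S' z (a + Ω z (S z a)) = S z a)
    (hsurj : ∀ a', ∃ a, a + Ω y (S y a) = a')
    (hΩskew : ∀ u v, dualPairing (Ω y u) v = -dualPairing (Ω y v) u)
    (hS'skew : ∀ a b, dualPairing b (S' y a) = -dualPairing a (S' y b))
    (hclosed : ∀ u v w, closedDefect Ω y u v w = 0)
    (hjac : ∀ a b c, poissonDefect S y a b c = 0) (a b c : (V →L[ℝ] ℝ) × ℝ) :
    poissonDefect S' y a b c = 0 := by
  obtain ⟨a, rfl⟩ := hsurj a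
  obtain ⟨b, rfl⟩ := hsurj b
  obtain ⟨c, rfl⟩ := hsurj c
  have hrel' : (fun z ↦ S' z ∘L (ContinuousLinearMap.id ℝ _ + Ω z ∘L S z)) =ᶠ[nhds y] S := by
    filter_upwards [hrel] with z hz
    exact ContinuousLinearMap.ext fun a ↦ by simpa using hz a
  have hd := (hS'.hasFDerivAt.clm_comp
    ((hΩ.hasFDerivAt.clm_comp hS.hasFDerivAt).const_add (ContinuousLinearMap.id ℝ _))).fderiv
  rw [hrel'.fderiv_eq] at hd
  have hD : ∀ X a, fderiv ℝ S' y X (a + Ω y (S y a)) = fderiv ℝ S y X a -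
      S' y (fderiv ℝ Ω y X (S y a) + Ω y (fderiv ℝ S y X a)) := by
    intro X a
    have := DFunLike.congr_fun (DFunLike.congr_fun hd X) a
    simp at this
    rw [map_add, map_add, eq_sub_iff_add_eq]
    refine Eq.trans ?_ this.symm
    abel
  have hA := hrel.self_of_nhds
  -- Skewness moves `S'` onto `b + Ω S b`, where it equals `S b`; the two terms that pair `Ω` with
  -- the derivative of `S` then cancel.
  have key : ∀ (X : V) (a b : (V →L[ℝ] ℝ) × ℝ),
      dualPairing (b + Ω y (S y b)) (fderiv ℝ S' y X (a + Ω y (S y a))) =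
        dualPairing b (fderiv ℝ S y X a) + dualPairing (fderiv ℝ Ω y X (S y a)) (S y b) := by
    intro X a b
    rw [hD, dualPairing_sub_right, hS'skew, hA, dualPairing_add_left, dualPairing_add_left,
      hΩskew (S y b)]
    ring
  have key2 : ∀ a b, dualPairing (b + Ω y (S y b)) (S y a) =
      dualPairing b (S y a) + dualPairing (Ω y (S y b)) (S y a) := fun a b ↦ by
    rw [dualPairing_add_left]
  have h := hclosed (S y c) (S y a) (S y b)
  have hj := hjac a b c
  unfold closedDefect at h
  unfold poissonDefect at hj ⊢
  rw [hA, hA, hA, key, key, key, key2 a b, key2 b c, key2 c a]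
  rw [hΩskew (S y b) (S y a), hΩskew (S y c) (S y b), hΩskew (S y a) (S y c)]
  linarith

end Gauge

variable [FiniteDimensional ℝ V]

/-- `pairFlat` as a continuous linear map of the pair `(θ, b)`. -/
def pairFlatCLM : ((V →L[ℝ] V →L[ℝ] ℝ) × (V →L[ℝ] ℝ)) →L[ℝ]
    ((V × ℝ) →L[ℝ] (V →L[ℝ] ℝ) × ℝ) :=
  LinearMap.toContinuousLinearMap
    { toFun := fun p ↦ pairFlat p.1 p.2
      map_add' := fun p q ↦ by
        ext <;> simp [pairFlat]
        ring
      map_smul' := fun r p ↦ by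
        ext <;> simp [pairFlat] }

/-- `pairSharp` as a continuous linear map of the pair `(P, e)`. -/
def pairSharpCLM : (((V →L[ℝ] ℝ) →L[ℝ] (V →L[ℝ] ℝ) →L[ℝ] ℝ) × V) →L[ℝ]
    (((V →L[ℝ] ℝ) × ℝ) →L[ℝ] V × ℝ) :=
  LinearMap.toContinuousLinearMap
    { toFun := fun p ↦ pairSharp p.1 p.2
      map_add' := fun p q ↦ by
        refine ContinuousLinearMap.ext fun a ↦ ?_
        refine dualPairing_ext fun b ↦ ?_
        simp only [add_apply]
        rw [dualPairing_add_right, dualPairing_pairSharp, dualPairing_pairSharp,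
          dualPairing_pairSharp]
        simp
        ring
      map_smul' := fun r p ↦ by
        refine ContinuousLinearMap.ext fun a ↦ ?_
        refine dualPairing_ext fun b ↦ ?_
        have : dualPairing b ((r • pairSharp p.1 p.2) a) =
            r * dualPairing b (pairSharp p.1 p.2 a) := by
          simp [dualPairing]; ring
        simp only [RingHom.id_apply]
        rw [this, dualPairing_pairSharp, dualPairing_pairSharp]
        simp
        ring }

theorem pairFlatCLM_apply (θ : V →L[ℝ] V →L[ℝ] ℝ) (b : V →L[ℝ] ℝ) :
    pairFlatCLM (θ, b) = pairFlat θ b := rfl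

theorem pairSharpCLM_apply (P : (V →L[ℝ] ℝ) →L[ℝ] (V →L[ℝ] ℝ) →L[ℝ] ℝ) (e : V) :
    pairSharpCLM (P, e) = pairSharp P e := rfl

theorem contDiffAt_pairFlat {n : WithTop ℕ∞} {θ : V → V →L[ℝ] V →L[ℝ] ℝ} {b : V → V →L[ℝ] ℝ} {y : V}
    (hθ : ContDiffAt ℝ n θ y) (hb : ContDiffAt ℝ n b y) :
    ContDiffAt ℝ n (fun z ↦ pairFlat (θ z) (b z)) y := by
  simp only [← pairFlatCLM_apply]
  exact (pairFlatCLM (V := V)).contDiff.contDiffAt.comp y (hθ.prodMk hb)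

theorem contDiffAt_pairSharp {n : WithTop ℕ∞} {P : V → (V →L[ℝ] ℝ) →L[ℝ] (V →L[ℝ] ℝ) →L[ℝ] ℝ}
    {e : V → V} {y : V} (hP : ContDiffAt ℝ n P y) (he : ContDiffAt ℝ n e y) :
    ContDiffAt ℝ n (fun z ↦ pairSharp (P z) (e z)) y := by
  simp only [← pairSharpCLM_apply]
  exact (pairSharpCLM (V := V)).contDiff.contDiffAt.comp y (hP.prodMk he)

theorem hasFDerivAt_pairFlat {θ : V → V →L[ℝ] V →L[ℝ] ℝ} {b : V → V →L[ℝ] ℝ} {y : V}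
    (hθ : DifferentiableAt ℝ θ y) (hb : DifferentiableAt ℝ b y) :
    HasFDerivAt (fun z ↦ pairFlat (θ z) (b z))
      (pairFlatCLM ∘L (fderiv ℝ θ y).prod (fderiv ℝ b y)) y := by
  simp only [← pairFlatCLM_apply]
  exact (pairFlatCLM (V := V)).hasFDerivAt.comp y (hθ.hasFDerivAt.prodMk hb.hasFDerivAt)

theorem hasFDerivAt_pairSharp {P : V → (V →L[ℝ] ℝ) →L[ℝ] (V →L[ℝ] ℝ) →L[ℝ] ℝ}
    {e : V → V} {y : V} (hP : DifferentiableAt ℝ P y) (he : DifferentiableAt ℝ e y) :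
    HasFDerivAt (fun z ↦ pairSharp (P z) (e z))
      (pairSharpCLM ∘L (fderiv ℝ P y).prod (fderiv ℝ e y)) y := by
  simp only [← pairSharpCLM_apply]
  exact (pairSharpCLM (V := V)).hasFDerivAt.comp y (hP.hasFDerivAt.prodMk he.hasFDerivAt)

/-- This is `d(d(e^t b)) = 0`: the second derivatives of `b` cancel by symmetry, and the terms
linear or quadratic in the scalar parts cancel in the cyclic sum. -/
theorem closedDefect_pairFlat {b : V → V →L[ℝ] ℝ} {y : V} (hb : ContDiffAt ℝ 2 b y)
    (u v w : V × ℝ) :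
    closedDefect (fun z ↦ pairFlat (flatExtDeriv b z) (b z)) y u v w = 0 := by
  have hb1 : DifferentiableAt ℝ b y := hb.differentiableAt (by norm_num)
  have hb2 : HasFDerivAt (fderiv ℝ b) (fderiv ℝ (fderiv ℝ b) y) y :=
    ((hb.fderiv_right (m := 1) (by norm_num)).differentiableAt (by norm_num)).hasFDerivAt
  let T : (V →L[ℝ] V →L[ℝ] ℝ) →L[ℝ] V →L[ℝ] V →L[ℝ] ℝ :=
    (ContinuousLinearMap.flipₗᵢ ℝ V V ℝ).toContinuousLinearEquiv
  have hθ : HasFDerivAt (flatExtDeriv b) (fderiv ℝ (fderiv ℝ b) y -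
      T ∘L fderiv ℝ (fderiv ℝ b) y) y :=
    hb2.sub (T.hasFDerivAt.comp y hb2)
  have hT : ∀ A v w, T A v w = A w v := fun A v w ↦ rfl
  have hsymm := hb.isSymmSndFDerivAt (by simp)
  have hD : ∀ X, fderiv ℝ (fun z ↦ pairFlat (flatExtDeriv b z) (b z)) y X =
      pairFlat (fderiv ℝ (flatExtDeriv b) y X) (fderiv ℝ b y X) := fun X ↦ by
    rw [(hasFDerivAt_pairFlat hθ.differentiableAt hb1).fderiv]; rfl
  simp only [closedDefect, hD, dualPairing_pairFlat, hθ.fderiv]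
  simp [flatExtDeriv, hT, hsymm.eq v.1 u.1, hsymm.eq w.1 u.1, hsymm.eq w.1 v.1]
  ring

end Flat

/-! ### The Jacobi identities on a vector space: brackets of functions against first-order tensor
identities. -/

section FlatJacobi

variable {V : Type*} [NormedAddCommGroup V] [NormedSpace ℝ V]

/-- The function `P(df, dg)` on a vector space. -/
def flatBracket (P : V → (V →L[ℝ] ℝ) →L[ℝ] (V →L[ℝ] ℝ) →L[ℝ] ℝ) (f g : V → ℝ) (y : V) : ℝ :=
  P y (fderiv ℝ f y) (fderiv ℝ g y)

/-- The function `df(e)` on a vector space. -/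
def flatDerivAlong (e : V → V) (f : V → ℝ) (y : V) : ℝ := fderiv ℝ f y (e y)

/-- The Jacobi identities for a pair `(P, e)` on a vector space at one point, in terms of the first
derivatives of `P` and `e`. -/
structure IsFlatJacobi (P : V → (V →L[ℝ] ℝ) →L[ℝ] (V →L[ℝ] ℝ) →L[ℝ] ℝ) (e : V → V) (y : V) :
    Prop where
  bivector : ∀ α β γ : V →L[ℝ] ℝ,
    (fderiv ℝ P y (sharp (P y) γ) α β + γ (e y) * P y α β) +
    (fderiv ℝ P y (sharp (P y) α) β γ + α (e y) * P y β γ) +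
    (fderiv ℝ P y (sharp (P y) β) γ α + β (e y) * P y γ α) = 0
  vector : ∀ α β : V →L[ℝ] ℝ,
    fderiv ℝ P y (e y) α β - β (fderiv ℝ e y (sharp (P y) α)) +
      α (fderiv ℝ e y (sharp (P y) β)) = 0

variable {P : V → (V →L[ℝ] ℝ) →L[ℝ] (V →L[ℝ] ℝ) →L[ℝ] ℝ} {e : V → V} {y : V} {f g h : V → ℝ}

theorem hasFDerivAt_fderiv_of_contDiffAt {F : Type*} [NormedAddCommGroup F] [NormedSpace ℝ F]
    {f : V → F} (hf : ContDiffAt ℝ 2 f y) :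
    HasFDerivAt (fderiv ℝ f) (fderiv ℝ (fderiv ℝ f) y) y :=
  ((hf.fderiv_right (m := 1) (by norm_num)).differentiableAt (by norm_num)).hasFDerivAt

theorem fderiv_flatBracket (hP : DifferentiableAt ℝ P y) (hf : ContDiffAt ℝ 2 f y)
    (hg : ContDiffAt ℝ 2 g y) (X : V) :
    fderiv ℝ (flatBracket P f g) y X = fderiv ℝ P y X (fderiv ℝ f y) (fderiv ℝ g y) +
      P y (fderiv ℝ (fderiv ℝ f) y X) (fderiv ℝ g y) +
      P y (fderiv ℝ f y) (fderiv ℝ (fderiv ℝ g) y X) := by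
  have := ((hP.hasFDerivAt.clm_apply (hasFDerivAt_fderiv_of_contDiffAt hf)).clm_apply
    (hasFDerivAt_fderiv_of_contDiffAt hg)).fderiv
  unfold flatBracket
  rw [this]
  simp
  ring

theorem fderiv_flatDerivAlong (he : DifferentiableAt ℝ e y) (hf : ContDiffAt ℝ 2 f y) (X : V) :
    fderiv ℝ (flatDerivAlong e f) y X =
      fderiv ℝ (fderiv ℝ f) y X (e y) + fderiv ℝ f y (fderiv ℝ e y X) := by
  have := ((hasFDerivAt_fderiv_of_contDiffAt hf).clm_apply he.hasFDerivAt).fderiv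
  unfold flatDerivAlong
  rw [this]
  simp
  ring

variable [FiniteDimensional ℝ V]

/-- The defect is affine in each scalar component: its value at zero scalars is the identity for
`[P, P]`, and the coefficient of each scalar is an instance of the identity for `[e, P]`. -/
theorem isFlatJacobi_iff_poissonDefect (hP : DifferentiableAt ℝ P y) (he : DifferentiableAt ℝ e y) :
    IsFlatJacobi P e y ↔
      ∀ a b c, poissonDefect (fun z ↦ pairSharp (P z) (e z)) y a b c = 0 := by
  have hD : ∀ X, fderiv ℝ (fun z ↦ pairSharp (P z) (e z)) y X =
      pairSharp (fderiv ℝ P y X) (fderiv ℝ e y X) := fun X ↦ by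
    rw [(hasFDerivAt_pairSharp hP he).fderiv, ← pairSharpCLM_apply]; rfl
  have hfst : ∀ a, (pairSharp (P y) (e y) a).1 = sharp (P y) a.1 + a.2 • e y := fun a ↦ by
    simp [pairSharp]
  have hsnd : ∀ a, (pairSharp (P y) (e y) a).2 = -a.1 (e y) := fun a ↦ by
    simp [pairSharp]
  have key : ∀ a b c, poissonDefect (fun z ↦ pairSharp (P z) (e z)) y a b c =
      ((fderiv ℝ P y (sharp (P y) c.1) a.1 b.1 + c.1 (e y) * P y a.1 b.1) +
      (fderiv ℝ P y (sharp (P y) a.1) b.1 c.1 + a.1 (e y) * P y b.1 c.1) +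
      (fderiv ℝ P y (sharp (P y) b.1) c.1 a.1 + b.1 (e y) * P y c.1 a.1)) +
      c.2 * (fderiv ℝ P y (e y) a.1 b.1 - b.1 (fderiv ℝ e y (sharp (P y) a.1)) +
        a.1 (fderiv ℝ e y (sharp (P y) b.1))) +
      a.2 * (fderiv ℝ P y (e y) b.1 c.1 - c.1 (fderiv ℝ e y (sharp (P y) b.1)) +
        b.1 (fderiv ℝ e y (sharp (P y) c.1))) +
      b.2 * (fderiv ℝ P y (e y) c.1 a.1 - a.1 (fderiv ℝ e y (sharp (P y) c.1)) +
        c.1 (fderiv ℝ e y (sharp (P y) a.1))) := by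
    intro a b c
    simp only [poissonDefect, hD, dualPairing_pairSharp, hfst, hsnd]
    simp
    ring
  constructor
  · intro h a b c
    rw [key, h.bivector, h.vector, h.vector, h.vector]
    ring
  · intro h
    have h1 : ∀ α β γ : V →L[ℝ] ℝ,
        (fderiv ℝ P y (sharp (P y) γ) α β + γ (e y) * P y α β) +
        (fderiv ℝ P y (sharp (P y) α) β γ + α (e y) * P y β γ) +
        (fderiv ℝ P y (sharp (P y) β) γ α + β (e y) * P y γ α) = 0 := fun α β γ ↦ by
      simpa [key] using h (α, 0) (β, 0) (γ, 0)
    refine ⟨h1, fun α β ↦ ?_⟩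
    have := h (α, 0) (β, 0) (0, 1)
    rw [key] at this
    simpa [sharp] using this

/-- The Hessians of `f`, `g`, `h` each occur twice with opposite signs and cancel by symmetry; what
remains is the tensor identity at the three differentials. -/
theorem IsFlatJacobi.schouten_self (H : IsFlatJacobi P e y) (hP : DifferentiableAt ℝ P y)
    (hskew : ∀ α β, P y α β = -P y β α)
    (hf : ContDiffAt ℝ 2 f y) (hg : ContDiffAt ℝ 2 g y) (hh : ContDiffAt ℝ 2 h y) :
    flatBracket P (flatBracket P f g) h y + flatBracket P (flatBracket P g h) f y +
      flatBracket P (flatBracket P h f) g y =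
    flatDerivAlong e f y * flatBracket P g h y + flatDerivAlong e g y * flatBracket P h f y +
      flatDerivAlong e h y * flatBracket P f g y := by
  have key : ∀ {u v : V → ℝ}, flatBracket P u v y = -fderiv ℝ u y (sharp (P y) (fderiv ℝ v y)) :=
    fun {u v} ↦ by rw [apply_sharp]; exact hskew _ _
  have hl : ∀ α β : V →L[ℝ] ℝ, P y α β = β (sharp (P y) α) := fun α β ↦ (apply_sharp _ _ _).symm
  have hr : ∀ α β : V →L[ℝ] ℝ, P y α β = -α (sharp (P y) β) := fun α β ↦ by
    rw [apply_sharp, hskew]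
  have H1 := H.bivector (fderiv ℝ f y) (fderiv ℝ g y) (fderiv ℝ h y)
  have sf := hf.isSymmSndFDerivAt (by simp)
  have sg := hg.isSymmSndFDerivAt (by simp)
  have sh := hh.isSymmSndFDerivAt (by simp)
  rw [key (u := flatBracket P f g), key (u := flatBracket P g h), key (u := flatBracket P h f),
    fderiv_flatBracket hP hf hg, fderiv_flatBracket hP hg hh, fderiv_flatBracket hP hh hf]
  rw [hr (fderiv ℝ (fderiv ℝ f) y _), hl _ (fderiv ℝ (fderiv ℝ g) y _),
    hr (fderiv ℝ (fderiv ℝ g) y _), hl _ (fderiv ℝ (fderiv ℝ h) y _),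
    hr (fderiv ℝ (fderiv ℝ h) y _), hl _ (fderiv ℝ (fderiv ℝ f) y _),
    sf.eq (sharp (P y) (fderiv ℝ h y)) (sharp (P y) (fderiv ℝ g y)),
    sg.eq (sharp (P y) (fderiv ℝ h y)) (sharp (P y) (fderiv ℝ f y)),
    sh.eq (sharp (P y) (fderiv ℝ f y)) (sharp (P y) (fderiv ℝ g y))]
  simp only [flatBracket, flatDerivAlong]
  linarith

theorem IsFlatJacobi.schouten_vector (H : IsFlatJacobi P e y) (hP : DifferentiableAt ℝ P y)
    (he : DifferentiableAt ℝ e y) (hskew : ∀ α β, P y α β = -P y β α)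
    (hf : ContDiffAt ℝ 2 f y) (hg : ContDiffAt ℝ 2 g y) :
    flatDerivAlong e (flatBracket P f g) y - flatBracket P (flatDerivAlong e f) g y -
      flatBracket P f (flatDerivAlong e g) y = 0 := by
  have hl : ∀ α β : V →L[ℝ] ℝ, P y α β = β (sharp (P y) α) := fun α β ↦ (apply_sharp _ _ _).symm
  have hr : ∀ α β : V →L[ℝ] ℝ, P y α β = -α (sharp (P y) β) := fun α β ↦ by
    rw [apply_sharp, hskew]
  have H1 := H.vector (fderiv ℝ f y) (fderiv ℝ g y)
  have sf := hf.isSymmSndFDerivAt (by simp)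
  have sg := hg.isSymmSndFDerivAt (by simp)
  have e1 : flatDerivAlong e (flatBracket P f g) y = _ := fderiv_flatBracket hP hf hg _
  have e2 : flatBracket P (flatDerivAlong e f) g y = _ := hr _ _
  have e3 : flatBracket P f (flatDerivAlong e g) y = _ := hl _ _
  rw [e1, e2, e3, fderiv_flatDerivAlong he hf, fderiv_flatDerivAlong he hg,
    hr (fderiv ℝ (fderiv ℝ f) y _), hl _ (fderiv ℝ (fderiv ℝ g) y _),
    sf.eq (e y), sg.eq (e y)]
  linarith

/-- Constant covectors detect the Jacobi identities. -/
theorem isFlatJacobi_of_linear (hP : DifferentiableAt ℝ P y)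
    (he : DifferentiableAt ℝ e y) (hskew : ∀ α β, P y α β = -P y β α)
    (h1 : ∀ f g h : V →L[ℝ] ℝ, flatBracket P (flatBracket P f g) h y +
      flatBracket P (flatBracket P g h) f y + flatBracket P (flatBracket P h f) g y =
      flatDerivAlong e f y * flatBracket P g h y + flatDerivAlong e g y * flatBracket P h f y +
      flatDerivAlong e h y * flatBracket P f g y)
    (h2 : ∀ f g : V →L[ℝ] ℝ, flatDerivAlong e (flatBracket P f g) y -
      flatBracket P (flatDerivAlong e f) g y - flatBracket P f (flatDerivAlong e g) y = 0) :
    IsFlatJacobi P e y := by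
  have key : ∀ {u v : V → ℝ}, flatBracket P u v y = -fderiv ℝ u y (sharp (P y) (fderiv ℝ v y)) :=
    fun {u v} ↦ by rw [apply_sharp]; exact hskew _ _
  have hl : ∀ α β : V →L[ℝ] ℝ, P y α β = β (sharp (P y) α) := fun α β ↦ (apply_sharp _ _ _).symm
  have hr : ∀ α β : V →L[ℝ] ℝ, P y α β = -α (sharp (P y) β) := fun α β ↦ by
    rw [apply_sharp, hskew]
  -- Linear test functions have no Hessian terms and realize every covector as a differential.
  have hlin : ∀ f : V →L[ℝ] ℝ, fderiv ℝ (fderiv ℝ f) y = 0 := fun f ↦ by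
    have : fderiv ℝ f = fun _ ↦ f := by ext1 z; exact f.fderiv
    rw [this, fderiv_const_apply]
  have hc : ∀ f : V →L[ℝ] ℝ, ContDiffAt ℝ 2 f y := fun f ↦ f.contDiff.contDiffAt
  constructor
  · intro α β γ
    have := h1 α β γ
    rw [key (u := flatBracket P α β), key (u := flatBracket P β γ), key (u := flatBracket P γ α),
      fderiv_flatBracket hP (hc _) (hc _), fderiv_flatBracket hP (hc _) (hc _),
      fderiv_flatBracket hP (hc _) (hc _)] at this
    simp only [hlin, flatBracket, flatDerivAlong, ContinuousLinearMap.fderiv] at this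
    simp at this
    linarith
  · intro α β
    have := h2 α β
    have e1 : flatDerivAlong e (flatBracket P α β) y = _ := fderiv_flatBracket hP (hc _) (hc _) _
    have e2 : flatBracket P (flatDerivAlong e α) β y = _ := hr _ _
    have e3 : flatBracket P α (flatDerivAlong e β) y = _ := hl _ _
    rw [e1, e2, e3, fderiv_flatDerivAlong he (hc _), fderiv_flatDerivAlong he (hc _)] at this
    simp only [hlin, ContinuousLinearMap.fderiv] at this
    simp at this
    linarith

end FlatJacobi

/-! ### Nonvanishing of `η ∧ θⁿ` against injectivity of `pairFlat θ η`. -/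

section Wedge

variable {W : Type*} [NormedAddCommGroup W] [NormedSpace ℝ W]
  {η : W →L[ℝ] ℝ} {θ : W →L[ℝ] W →L[ℝ] ℝ}

/-- The index type `{0, 1, …, 2n}`, seen as `{0}` and the pairs `{2i + 1, 2i + 2}`. -/
def pairIndexEquiv (n : ℕ) : Option (Fin n × Bool) ≃ Fin (2 * n + 1) :=
  Equiv.ofBijective
    (fun o ↦ o.elim 0 fun p ↦ ⟨2 * (p.1 : ℕ) + 1 + p.2.toNat, by
      have := p.1.2; have := p.2.toNat_lt; omega⟩) <| by
    rw [Fintype.bijective_iff_injective_and_card]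
    constructor
    · rintro (_ | ⟨i, a⟩) (_ | ⟨j, b⟩) h
      · rfl
      · have h' : 0 = 2 * (j : ℕ) + 1 + b.toNat := by simpa [Fin.ext_iff] using h
        omega
      · simp [Fin.ext_iff] at h
      · have h' : 2 * (i : ℕ) + 1 + a.toNat = 2 * (j : ℕ) + 1 + b.toNat := by
          simpa [Fin.ext_iff] using h
        have ha := a.toNat_lt
        have hb := b.toNat_lt
        have h1 : i = j := Fin.ext (by omega)
        have h2 : a = b := by cases a <;> cases b <;> simp at h' ⊢ <;> omega
        rw [h1, h2]
    · simp; ring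

/-- The multilinear map `v ↦ η(v₀) ∏ θ(v_{2i+1}, v_{2i+2})` whose alternation is `η ∧ θⁿ`. -/
def pairProd (n : ℕ) (η : W →L[ℝ] ℝ) (θ : W →L[ℝ] W →L[ℝ] ℝ) :
    MultilinearMap ℝ (fun _ : Option (Fin n × Bool) ↦ W) ℝ where
  toFun v := η (v none) * ∏ i, θ (v (some (i, false))) (v (some (i, true)))
  map_update_add' := by
    intro _ v o x y
    match o with
    | none => simp; ring
    | some (j, false) =>
      simp only [ne_eq, reduceCtorEq, not_false_eq_true, Function.update_of_ne, ← mul_add]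
      congr 1
      symm
      apply Finset.prod_add_prod_eq (Finset.mem_univ j)
      · simp
      · intro i _ hij; simp [hij]
      · intro i _ hij; simp [hij]
    | some (j, true) =>
      simp only [ne_eq, reduceCtorEq, not_false_eq_true, Function.update_of_ne, ← mul_add]
      congr 1
      symm
      apply Finset.prod_add_prod_eq (Finset.mem_univ j)
      · simp
      · intro i _ hij; simp [hij]
      · intro i _ hij; simp [hij]
  map_update_smul' := by
    intro _ v o c x
    match o with
    | none => simp; ring
    | some (j, false) =>
      simp only [ne_eq, reduceCtorEq, not_false_eq_true, Function.update_of_ne, smul_eq_mul]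
      rw [mul_left_comm]
      congr 1
      rw [← Finset.mul_prod_erase _ _ (Finset.mem_univ j),
        ← Finset.mul_prod_erase Finset.univ _ (Finset.mem_univ j), ← mul_assoc]
      congr 1
      · simp
      · refine Finset.prod_congr rfl fun i hi ↦ ?_
        have hij := Finset.ne_of_mem_erase hi
        simp [hij]
    | some (j, true) =>
      simp only [ne_eq, reduceCtorEq, not_false_eq_true, Function.update_of_ne, smul_eq_mul]
      rw [mul_left_comm]
      congr 1
      rw [← Finset.mul_prod_erase _ _ (Finset.mem_univ j),
        ← Finset.mul_prod_erase Finset.univ _ (Finset.mem_univ j), ← mul_assoc]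
      congr 1
      · simp
      · refine Finset.prod_congr rfl fun i hi ↦ ?_
        have hij := Finset.ne_of_mem_erase hi
        simp [hij]

theorem pairProd_apply (n : ℕ) (η : W →L[ℝ] ℝ) (θ : W →L[ℝ] W →L[ℝ] ℝ)
    (v : Option (Fin n × Bool) → W) :
    pairProd n η θ v = η (v none) * ∏ i, θ (v (some (i, false))) (v (some (i, true))) := rfl

/-- Conjugating permutations by `pairIndexEquiv` preserves signs. As an alternating map, `η ∧ θⁿ`
vanishes on dependent families. -/
theorem wedgePowEval_eq (n : ℕ) (η : W →L[ℝ] ℝ) (θ : W →L[ℝ] W →L[ℝ] ℝ)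
    (v : Fin (2 * n + 1) → W) :
    wedgePowEval n η θ v = (1 / 2 ^ n : ℝ) *
      MultilinearMap.alternatization (pairProd n η θ) (v ∘ pairIndexEquiv n) := by
  rw [wedgePowEval, MultilinearMap.alternatization_apply]
  congr 1
  symm
  refine Fintype.sum_equiv (pairIndexEquiv n).permCongr _ _ fun σ ↦ ?_
  rw [Equiv.Perm.sign_permCongr, MultilinearMap.domDomCongr_apply, pairProd_apply, Units.smul_def,
    zsmul_eq_mul]
  have h0 : (pairIndexEquiv n).symm 0 = none := by
    rw [Equiv.symm_apply_eq]; rfl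
  have h1 : ∀ i : Fin n, (pairIndexEquiv n).symm ⟨2 * (i : ℕ) + 1, by omega⟩ = some (i, false) :=
    fun i ↦ by rw [Equiv.symm_apply_eq]; rfl
  have h2 : ∀ i : Fin n, (pairIndexEquiv n).symm ⟨2 * (i : ℕ) + 2, by omega⟩ = some (i, true) :=
    fun i ↦ by rw [Equiv.symm_apply_eq]; rfl
  simp [Equiv.permCongr_apply, h0, h1, h2]

/-- A vector `X` with `♭ X = 0` is killed by both `η` and `θ`, so `η ∧ θⁿ` vanishes whenever `X` is
an argument. A family on which it does not vanish is a basis by the dimension count, and `X` can be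
exchanged into it if `X ≠ 0`. -/
theorem contactFlat_injective_of_wedgePowEval {n : ℕ} (hn : Module.finrank ℝ W = 2 * n + 1)
    (hθ : ∀ v w, θ v w = -θ w v) {v : Fin (2 * n + 1) → W} (hv : wedgePowEval n η θ v ≠ 0) :
    Function.Injective (contactFlat θ η) := by
  refine (injective_iff_map_eq_zero _).2 fun X hX ↦ ?_
  obtain ⟨hθX, hηX⟩ := contactFlat_ker hθ hX
  by_contra hX0
  set A := MultilinearMap.alternatization (pairProd n η θ) with hA
  have hzero : ∀ (w : Option (Fin n × Bool) → W) (o), w o = X → A w = 0 := by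
    intro w o hw
    rw [hA, MultilinearMap.alternatization_apply]
    refine Finset.sum_eq_zero fun σ _ ↦ ?_
    rw [MultilinearMap.domDomCongr_apply, pairProd_apply]
    have hτ : w (σ (σ.symm o)) = X := by rw [σ.apply_symm_apply, hw]
    have hθX' : ∀ w, θ w X = 0 := fun w ↦ by rw [hθ, hθX]; simp
    suffices h : η (w (σ none)) * ∏ i, θ (w (σ (some (i, false)))) (w (σ (some (i, true)))) = 0 by
      rw [h, smul_zero]
    rcases hσ : σ.symm o with _ | ⟨i, _ | _⟩
    · rw [hσ] at hτ
      rw [hτ, hηX, zero_mul]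
    · rw [hσ] at hτ
      rw [Finset.prod_eq_zero (Finset.mem_univ i), mul_zero]
      rw [hτ, hθX]; simp
    · rw [hσ] at hτ
      rw [Finset.prod_eq_zero (Finset.mem_univ i), mul_zero]
      rw [hτ, hθX']
  rw [wedgePowEval_eq] at hv
  have hAv : A (v ∘ pairIndexEquiv n) ≠ 0 := right_ne_zero_of_mul hv
  set u := v ∘ pairIndexEquiv n
  have hli : LinearIndependent ℝ u := by
    by_contra h
    exact hAv (A.map_linearDependent u h)
  have hcard : Fintype.card (Option (Fin n × Bool)) = Module.finrank ℝ W := by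
    simp [hn]; ring
  let b := basisOfLinearIndependentOfCardEqFinrank hli hcard
  have hb : ∀ i, b i = u i := fun i ↦ by simp [b]
  obtain ⟨o, ho⟩ : ∃ o, b.repr X o ≠ 0 := by
    by_contra! h
    exact hX0 (b.repr.map_eq_zero_iff.1 (Finsupp.ext h))
  have hsum : X = ∑ i, b.repr X i • u i := by
    conv_lhs => rw [← b.sum_repr X]
    simp [hb]
  -- Expanding `X` in the basis, only the `o`-th term survives, so this value is also the nonzero
  -- `o`-th coordinate of `X` times `A u`.
  have h1 : A (Function.update u o X) = 0 := hzero _ o (by simp)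
  rw [hsum, A.map_update_sum, Finset.sum_eq_single o] at h1
  · rw [A.map_update_smul, Function.update_eq_self] at h1
    exact (smul_ne_zero ho hAv) h1
  · intro i _ hi
    rw [A.map_update_smul, A.map_update_self _ hi.symm, smul_zero]
  · simp

variable [FiniteDimensional ℝ W]

/-- The Gram matrix is skew of odd size, so its determinant equals its own negative. -/
theorem exists_ker_of_odd_finrank {n : ℕ} (hn : Module.finrank ℝ W = 2 * n + 1)
    (hθ : ∀ v w, θ v w = -θ w v) : ∃ X, X ≠ 0 ∧ θ X = 0 := by
  let b := Module.finBasisOfFinrankEq ℝ W hn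
  let A : Matrix (Fin (2 * n + 1)) (Fin (2 * n + 1)) ℝ := Matrix.of fun i j ↦ θ (b i) (b j)
  have hA : A.transpose = -A := by
    ext i j
    simpa [A] using hθ _ _
  have hdet : A.det = 0 := by
    have h := Matrix.det_transpose A
    rw [hA, Matrix.det_neg] at h
    simp [pow_succ] at h
    linarith
  obtain ⟨c, hc, hAc⟩ := Matrix.exists_mulVec_eq_zero_iff.2 hdet
  have hsum : ∀ i, θ (b i) (∑ j, c j • b j) = 0 := fun i ↦ by
    have := congrFun hAc i
    simp only [Matrix.mulVec, dotProduct, A, Matrix.of_apply, Pi.zero_apply] at this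
    simpa [mul_comm] using this
  refine ⟨∑ j, c j • b j, fun h0 ↦ hc ?_, ?_⟩
  · exact funext (Fintype.linearIndependent_iff.1 b.linearIndependent c h0)
  · have : (θ (∑ j, c j • b j)).toLinearMap = 0 := b.ext fun i ↦ by
      have h := hθ (∑ j, c j • b j) (b i)
      rw [hsum, neg_zero] at h
      exact h
    ext w
    exact LinearMap.congr_fun this w

/-- The odd dimension supplies `E ≠ 0` in the kernel of `θ`, and `η(E) ≠ 0` by injectivity of `♭`.
Evaluating `θ X + f η = 0` on `E` gives `f = 0`, after which injectivity of `♭` applies again. -/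
theorem pairFlat_injective_of_wedgePowEval {n : ℕ} (hn : Module.finrank ℝ W = 2 * n + 1)
    (hθ : ∀ v w, θ v w = -θ w v) {v : Fin (2 * n + 1) → W} (hv : wedgePowEval n η θ v ≠ 0) :
    Function.Injective (pairFlat θ η) := by
  have hinj := contactFlat_injective_of_wedgePowEval hn hθ hv
  have hker : ∀ X, θ X = 0 → η X = 0 → X = 0 := fun X h1 h2 ↦
    (injective_iff_map_eq_zero _).1 hinj X (by simp [contactFlat, h1, h2])
  obtain ⟨E, hE0, hE⟩ := exists_ker_of_odd_finrank hn hθ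
  have hηE : η E ≠ 0 := fun h ↦ hE0 (hker E hE h)
  refine (injective_iff_map_eq_zero _).2 ?_
  rintro ⟨X, f⟩ hX
  have h1 : θ X + f • η = 0 := by simpa [pairFlat] using congrArg Prod.fst hX
  have h2 : η X = 0 := by simpa [pairFlat] using congrArg Prod.snd hX
  have hf : f = 0 := by
    have h3 := DFunLike.congr_fun h1 E
    have h4 : θ X E = 0 := by rw [hθ, hE]; simp
    simpa [h4, hηE] using h3
  rw [hf, zero_smul, add_zero] at h1
  rw [hker X h1 h2, hf]
  rfl

/-- Symplectic Gram–Schmidt inside the kernel of `η`, adding one pair at a time; only the values of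
`e` and `f` below `k` matter. -/
theorem exists_symplectic_family (hθ : ∀ v w, θ v w = -θ w v)
    (hinj : Function.Injective (pairFlat θ η)) (k : ℕ) (hk : 2 * k + 1 ≤ Module.finrank ℝ W) :
    ∃ e f : ℕ → W, ∀ i < k, η (e i) = 0 ∧ η (f i) = 0 ∧ ∀ j < k, θ (e i) (e j) = 0 ∧
      θ (f i) (f j) = 0 ∧ θ (e i) (f j) = if i = j then 1 else 0 := by
  induction k with
  | zero => exact ⟨0, 0, by simp⟩
  | succ k ih =>
    obtain ⟨e, f, hef⟩ := ih (by omega)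
    obtain ⟨E, hE1, hE2⟩ := exists_reeb hθ hinj
    -- The new vector `X` must be killed by `η` and orthogonal to the `k` pairs: `2k + 1` linear
    -- conditions in dimension at least `2k + 3`.
    let L : W →ₗ[ℝ] ℝ × (Fin k → ℝ) × (Fin k → ℝ) :=
      η.toLinearMap.prod ((LinearMap.pi fun i : Fin k ↦ (θ (e i)).toLinearMap).prod
        (LinearMap.pi fun i : Fin k ↦ (θ (f i)).toLinearMap))
    have hL : L.ker ≠ ⊥ := LinearMap.ker_ne_bot_of_finrank_lt (by simp; omega)
    obtain ⟨X, hXL, hX0⟩ := Submodule.exists_mem_ne_zero_of_ne_bot hL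
    rw [LinearMap.mem_ker] at hXL
    have hηX : η X = 0 := congrArg Prod.fst hXL
    have heX : ∀ i < k, θ (e i) X = 0 := fun i hi ↦ congrFun (congrArg (fun p ↦ p.2.1) hXL) ⟨i, hi⟩
    have hfX : ∀ i < k, θ (f i) X = 0 := fun i hi ↦ congrFun (congrArg (fun p ↦ p.2.2) hXL) ⟨i, hi⟩
    obtain ⟨Y', hY'⟩ : ∃ Y', θ X Y' ≠ 0 := by
      by_contra! h
      have hθX : θ X = 0 := ContinuousLinearMap.ext h
      have : pairFlat θ η (X, 0) = 0 := by simp [pairFlat, hθX, hηX]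
      exact hX0 (congrArg Prod.fst ((injective_iff_map_eq_zero _).1 hinj _ this))
    -- Subtracting the components of `Y'` along `E` and along the earlier pairs does not change
    -- `θ(X, Y')`, as `X` is orthogonal to all of them; the scalar then normalizes `θ(X, Y)` to `1`.
    let Y := (θ X Y')⁻¹ • (Y' - η Y' • E -
      ∑ i ∈ Finset.range k, (θ (e i) Y' • f i - θ (f i) Y' • e i))
    have hY : ∀ l : W →L[ℝ] ℝ, l Y = (θ X Y')⁻¹ * (l Y' - η Y' * l E -
        ∑ i ∈ Finset.range k, (θ (e i) Y' * l (f i) - θ (f i) Y' * l (e i))) := fun l ↦ by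
      simp only [Y, map_smul, map_sub, map_sum, smul_eq_mul]
    have hηY : η Y = 0 := by
      have : ∑ i ∈ Finset.range k, (θ (e i) Y' * η (f i) - θ (f i) Y' * η (e i)) = 0 :=
        Finset.sum_eq_zero fun i hi ↦ by
          obtain ⟨h1, h2, -⟩ := hef i (Finset.mem_range.1 hi); rw [h1, h2]; ring
      rw [hY, this, hE2]; ring
    have hEr : ∀ w, θ w E = 0 := fun w ↦ by rw [hθ, hE1]; simp
    have hXe : ∀ i < k, θ X (e i) = 0 := fun i hi ↦ by rw [hθ, heX i hi, neg_zero]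
    have hXf : ∀ i < k, θ X (f i) = 0 := fun i hi ↦ by rw [hθ, hfX i hi, neg_zero]
    have hXY : θ X Y = 1 := by
      have : ∑ i ∈ Finset.range k, (θ (e i) Y' * θ X (f i) - θ (f i) Y' * θ X (e i)) = 0 :=
        Finset.sum_eq_zero fun i hi ↦ by
          rw [hXe i (Finset.mem_range.1 hi), hXf i (Finset.mem_range.1 hi)]; ring
      rw [hY, this, hEr]; field_simp; ring
    have heY : ∀ j < k, θ (e j) Y = 0 := fun j hj ↦ by
      have : ∑ i ∈ Finset.range k, (θ (e i) Y' * θ (e j) (f i) - θ (f i) Y' * θ (e j) (e i)) =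
          θ (e j) Y' := by
        rw [Finset.sum_eq_single_of_mem j (Finset.mem_range.2 hj)]
        · obtain ⟨h1, h2, h3⟩ := (hef j hj).2.2 j hj
          simp [h1, h3]
        · intro i hi hij
          obtain ⟨h1, h2, h3⟩ := (hef j hj).2.2 i (Finset.mem_range.1 hi)
          simp [h1, h3, hij.symm]
      rw [hY, this, hEr]; ring
    have hfY : ∀ j < k, θ (f j) Y = 0 := fun j hj ↦ by
      have : ∑ i ∈ Finset.range k, (θ (e i) Y' * θ (f j) (f i) - θ (f i) Y' * θ (f j) (e i)) =
          θ (f j) Y' := by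
        rw [Finset.sum_eq_single_of_mem j (Finset.mem_range.2 hj)]
        · obtain ⟨h1, h2, h3⟩ := (hef j hj).2.2 j hj
          rw [hθ (f j) (e j)]
          simp [h2, h3]
        · intro i hi hij
          obtain ⟨h1, h2, h3⟩ := (hef i (Finset.mem_range.1 hi)).2.2 j hj
          rw [hθ (f j) (e i), hθ (f j) (f i)]
          simp [h2, h3, hij]
      rw [hY, this, hEr]; ring
    have hself : ∀ w, θ w w = 0 := fun w ↦ by linarith [hθ w w]
    refine ⟨Function.update e k X, Function.update f k Y, fun i hi ↦ ?_⟩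
    rcases (Nat.lt_succ_iff_lt_or_eq.1 hi) with hi | rfl
    · refine ⟨by simp [hi.ne, hef i hi], by simp [hi.ne, hef i hi], fun j hj ↦ ?_⟩
      rcases (Nat.lt_succ_iff_lt_or_eq.1 hj) with hj | rfl
      · simpa [hi.ne, hj.ne] using (hef i hi).2.2 j hj
      · simp [hi.ne, heX i hi, heY i hi, hfY i hi]
    · refine ⟨by simpa using hηX, by simpa using hηY, fun j hj ↦ ?_⟩
      rcases (Nat.lt_succ_iff_lt_or_eq.1 hj) with hj | rfl
      · simp [hj.ne, hj.ne', hXe j hj, hXf j hj, hθ Y (f j), hfY j hj]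
      · simp [hself, hXY]

/-- A permutation of `{0, …, 2n}` that fixes `0` and permutes the pairs `{2i + 1, 2i + 2}` has as
its sign the product of the signs inside the pairs. -/
theorem sign_of_preserves_pairs {n : ℕ} (σ : Equiv.Perm (Option (Fin n × Bool))) (h0 : σ none = none)
    (s : Fin n → ℝ)
    (hs : ∀ i, ∃ k a, σ (some (i, false)) = some (k, a) ∧ σ (some (i, true)) = some (k, !a) ∧
      s i = if a then -1 else 1) :
    ((Equiv.Perm.sign σ : ℤ) : ℝ) * ∏ i, s i = 1 := by
  choose ρ a h1 h2 h3 using hs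
  have hρ : Function.Bijective ρ := by
    rw [← Finite.surjective_iff_bijective]
    intro k
    rcases h : σ.symm (some (k, false)) with _ | ⟨i, b⟩
    · rw [Equiv.symm_apply_eq, h0] at h
      exact absurd h (by simp)
    · rw [Equiv.symm_apply_eq] at h
      refine ⟨i, ?_⟩
      cases b
      · rw [h1] at h; simp at h; exact h.1.symm
      · rw [h2] at h; simp at h; exact h.1.symm
  let r : Equiv.Perm (Fin n) := Equiv.ofBijective ρ hρ
  let κ : Fin n → Equiv.Perm Bool := fun i ↦ if a i then Equiv.swap false true else 1
  have hκ : ∀ i b, κ i b = xor b (a i) := by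
    intro i b
    cases h : a i <;> cases b <;> simp [κ, h]
  -- Swaps inside the pairs followed by the permutation `r` of the pairs. The latter acts alike on
  -- both members, so its sign is `(sign r)² = 1`.
  let τ : Equiv.Perm (Fin n × Bool) :=
    Equiv.prodCongrLeft (fun _ : Bool ↦ r) * Equiv.prodCongrRight κ
  have hσ : σ = Equiv.optionCongr τ := by
    ext1 o
    rcases o with _ | ⟨i, _ | _⟩
    · simp [h0]
    · rw [h1]; simp [τ, hκ, r]
    · rw [h2]; simp [τ, hκ, r]
  have hsign : Equiv.Perm.sign σ = ∏ i, Equiv.Perm.sign (κ i) := by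
    rw [hσ, Equiv.optionCongr_sign, Equiv.Perm.sign_mul, Equiv.Perm.sign_prodCongrLeft,
      Equiv.Perm.sign_prodCongrRight]
    simp
  have hs' : ∀ i, s i = ((Equiv.Perm.sign (κ i) : ℤ) : ℝ) := by
    intro i
    rw [h3]
    cases h : a i <;> simp [κ, h]
  rw [hsign, Finset.prod_congr rfl fun i _ ↦ hs' i]
  push_cast
  rw [← Finset.prod_mul_distrib]
  refine Finset.prod_eq_one fun i _ ↦ ?_
  rcases Int.units_eq_one_or (Equiv.Perm.sign (κ i)) with h | h <;> simp [h]

/-- On the Reeb vector followed by a symplectic family, a permutation contributes only if it fixes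
the Reeb slot and preserves the pairs. Its sign then cancels the signs of the values of `θ`, so
every nonzero term is `+1`. The identity contributes, hence the sum is positive. -/
theorem exists_wedgePowEval_ne_zero {n : ℕ} (hn : Module.finrank ℝ W = 2 * n + 1)
    (hθ : ∀ v w, θ v w = -θ w v) (hinj : Function.Injective (pairFlat θ η)) :
    ∃ v : Fin (2 * n + 1) → W, wedgePowEval n η θ v ≠ 0 := by
  obtain ⟨E, hE1, hE2⟩ := exists_reeb hθ hinj
  obtain ⟨e, f, hef⟩ := exists_symplectic_family hθ hinj n hn.ge
  let u : Option (Fin n × Bool) → W := fun o ↦ o.elim E fun p ↦ if p.2 then f p.1 else e p.1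
  have hη : ∀ p, η (u (some p)) = 0 := by
    rintro ⟨i, _ | _⟩
    · exact (hef i i.2).1
    · exact (hef i i.2).2.1
  have hu : ∀ (i j : Fin n) (a b : Bool), θ (u (some (i, a))) (u (some (j, b))) =
      if i = j ∧ b = !a then (if a then -1 else 1) else 0 := by
    intro i j a b
    obtain ⟨h1, h2, h3⟩ := (hef i i.2).2.2 j j.2
    obtain ⟨-, -, h4⟩ := (hef j j.2).2.2 i i.2
    cases a <;> cases b
    · simpa [u] using h1
    · simpa [u, Fin.ext_iff] using h3
    · have : θ (f i) (e j) = -if (j : ℕ) = i then 1 else 0 := by rw [hθ, h4]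
      rw [show θ (u (some (i, true))) (u (some (j, false))) = θ (f i) (e j) from rfl, this]
      by_cases hij : i = j
      · simp [hij]
      · simp [hij, Fin.val_ne_of_ne (Ne.symm hij)]
    · simpa [u] using h2
  have hterm : ∀ σ : Equiv.Perm (Option (Fin n × Bool)),
      pairProd n η θ (u ∘ σ) ≠ 0 →
        ((Equiv.Perm.sign σ : ℤ) : ℝ) * pairProd n η θ (u ∘ σ) = 1 := by
    intro σ hσ
    rw [pairProd_apply] at hσ ⊢
    have h0 : σ none = none := by
      by_contra h
      obtain ⟨p, hp⟩ := Option.ne_none_iff_exists'.1 h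
      apply hσ
      simp [hp, hη]
    have hne : ∀ i, ∃ p q, σ (some (i, false)) = some p ∧ σ (some (i, true)) = some q := by
      intro i
      obtain ⟨p, hp⟩ := Option.ne_none_iff_exists'.1 fun h : σ (some (i, false)) = none ↦ by
        simpa using σ.injective (h.trans h0.symm)
      obtain ⟨q, hq⟩ := Option.ne_none_iff_exists'.1 fun h : σ (some (i, true)) = none ↦ by
        simpa using σ.injective (h.trans h0.symm)
      exact ⟨p, q, hp, hq⟩
    have hEη : η (u (σ none)) = 1 := by rw [h0]; exact hE2
    simp only [Function.comp_apply, hEη, one_mul] at hσ ⊢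
    apply sign_of_preserves_pairs σ h0
    intro i
    obtain ⟨⟨k, a⟩, ⟨l, b⟩, hp, hq⟩ := hne i
    have hi := Finset.prod_ne_zero_iff.1 hσ i (Finset.mem_univ i)
    rw [hp, hq, hu] at hi ⊢
    have hkl : k = l ∧ b = !a := by
      by_contra h
      exact hi (if_neg h)
    refine ⟨k, a, rfl, ?_, ?_⟩
    · rw [hkl.1, hkl.2]
    · rw [if_pos hkl]
  refine ⟨u ∘ (pairIndexEquiv n).symm, ?_⟩
  rw [wedgePowEval_eq]
  refine mul_ne_zero (by positivity) (ne_of_gt ?_)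
  have : (u ∘ (pairIndexEquiv n).symm) ∘ pairIndexEquiv n = u := by ext; simp
  rw [this, MultilinearMap.alternatization_apply]
  have hval : ∀ σ : Equiv.Perm (Option (Fin n × Bool)),
      Equiv.Perm.sign σ • (MultilinearMap.domDomCongr σ (pairProd n η θ)) u =
        ((Equiv.Perm.sign σ : ℤ) : ℝ) * pairProd n η θ (u ∘ σ) := fun σ ↦ by
    rw [Units.smul_def, zsmul_eq_mul]; rfl
  simp only [hval]
  refine Finset.sum_pos' (fun σ _ ↦ ?_) ⟨1, Finset.mem_univ _, ?_⟩
  · by_cases h : pairProd n η θ (u ∘ σ) = 0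
    · rw [h, mul_zero]
    · rw [hterm σ h]; exact zero_le_one
  · have h1 : pairProd n η θ (u ∘ (1 : Equiv.Perm (Option (Fin n × Bool)))) = 1 := by
      have hE : η (u none) = 1 := hE2
      rw [pairProd_apply]
      simp [hE, hu]
    rw [hterm 1 (by rw [h1]; exact one_ne_zero)]
    exact one_pos

end Wedge

/-! ### Tensor fields in the preferred charts. -/

section Chart

variable {V : Type*} [NormedAddCommGroup V] [NormedSpace ℝ V]
  {M : Type*} [TopologicalSpace M] [ChartedSpace V M]

theorem contDiffAt_iff_of_eventuallyEq {F : Type*} [NormedAddCommGroup F] [NormedSpace ℝ F]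
    {f g : V → F} {y : V} {n : WithTop ℕ∞} (h : f =ᶠ[nhds y] g) :
    ContDiffAt ℝ n f y ↔ ContDiffAt ℝ n g y :=
  ⟨fun H ↦ H.congr_of_eventuallyEq h.symm, fun H ↦ H.congr_of_eventuallyEq h⟩

/-- The derivative of the preferred chart at `x`, at the point of `M` with coordinates `y`. -/
def chartDeriv (x : M) (y : V) : V →L[ℝ] V :=
  mfderiv 𝓘(ℝ, V) 𝓘(ℝ, V) (extChartAt 𝓘(ℝ, V) x) ((extChartAt 𝓘(ℝ, V) x).symm y)

/-- The derivative of the inverse of the preferred chart at `x`. -/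
def chartSymmDeriv (x : M) (y : V) : V →L[ℝ] V :=
  mfderiv 𝓘(ℝ, V) 𝓘(ℝ, V) (extChartAt 𝓘(ℝ, V) x).symm y

theorem chartRep_eq (η : CovectorField V M) (x : M) (y : V) :
    chartRep η x y = (show V →L[ℝ] ℝ from η ((extChartAt 𝓘(ℝ, V) x).symm y)) ∘L
      chartSymmDeriv x y := rfl

/-- A vector field in the preferred chart at `x`. -/
def chartVector (E : TangentField V M) (x : M) (y : V) : V :=
  chartDeriv x y (E ((extChartAt 𝓘(ℝ, V) x).symm y))

/-- A bivector field in the preferred chart at `x`. -/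
def chartBivector (π : BicontravariantField V M) (x : M) (y : V) :
    (V →L[ℝ] ℝ) →L[ℝ] (V →L[ℝ] ℝ) →L[ℝ] ℝ :=
  (show (V →L[ℝ] ℝ) →L[ℝ] (V →L[ℝ] ℝ) →L[ℝ] ℝ from
    π ((extChartAt 𝓘(ℝ, V) x).symm y)).bilinearComp
    ((chartDeriv x y).precomp ℝ) ((chartDeriv x y).precomp ℝ)

theorem chartBivector_apply (π : BicontravariantField V M) (x : M) (y : V) (α β : V →L[ℝ] ℝ) :
    chartBivector π x y α β = (show (V →L[ℝ] ℝ) →L[ℝ] (V →L[ℝ] ℝ) →L[ℝ] ℝ from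
    π ((extChartAt 𝓘(ℝ, V) x).symm y)) (α ∘L chartDeriv x y) (β ∘L chartDeriv x y) := rfl

theorem contMDiffAt_iff_comp_symm {F : Type*} [NormedAddCommGroup F] [NormedSpace ℝ F]
    {f : M → F} {x : M} {n : WithTop ℕ∞} [IsManifold 𝓘(ℝ, V) n M] :
    ContMDiffAt 𝓘(ℝ, V) 𝓘(ℝ, F) n f x ↔
      ContDiffAt ℝ n (f ∘ (extChartAt 𝓘(ℝ, V) x).symm) (extChartAt 𝓘(ℝ, V) x x) := by
  rw [contMDiffAt_iff_source, modelWithCornersSelf_coe, Set.range_id, contMDiffWithinAt_univ,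
    contMDiffAt_iff_contDiffAt]

theorem target_mem_nhds (x : M) :
    ∀ᶠ y in nhds (extChartAt 𝓘(ℝ, V) x x), y ∈ (extChartAt 𝓘(ℝ, V) x).target :=
  extChartAt_target_mem_nhds x

theorem symm_mem_source {x : M} {y : V} (hy : y ∈ (extChartAt 𝓘(ℝ, V) x).target) :
    (extChartAt 𝓘(ℝ, V) x).symm y ∈ (chartAt V x).source := by
  simpa using (extChartAt 𝓘(ℝ, V) x).map_target hy

variable [IsManifold 𝓘(ℝ, V) ∞ M]

instance isManifold_one : IsManifold 𝓘(ℝ, V) 1 M := .of_le (n := ∞) (by norm_num)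

theorem chartDeriv_comp_chartSymmDeriv {x : M} {y : V} (hy : y ∈ (extChartAt 𝓘(ℝ, V) x).target) :
    chartDeriv x y ∘L chartSymmDeriv x y = ContinuousLinearMap.id ℝ V := by
  have := mfderiv_extChartAt_comp_mfderivWithin_extChartAt_symm hy
  simp only [modelWithCornersSelf_coe, Set.range_id, mfderivWithin_univ] at this
  exact this

theorem chartSymmDeriv_comp_chartDeriv {x : M} {y : V} (hy : y ∈ (extChartAt 𝓘(ℝ, V) x).target) :
    chartSymmDeriv x y ∘L chartDeriv x y = ContinuousLinearMap.id ℝ V := by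
  have := mfderivWithin_extChartAt_symm_comp_mfderiv_extChartAt hy
  simp only [modelWithCornersSelf_coe, Set.range_id, mfderivWithin_univ] at this
  exact this

theorem continuousLinearMapAt_eq_chartDeriv {x : M} {y : V}
    (hy : y ∈ (extChartAt 𝓘(ℝ, V) x).target) :
    (trivializationAt V (TangentSpace 𝓘(ℝ, V)) x).continuousLinearMapAt ℝ
      ((extChartAt 𝓘(ℝ, V) x).symm y) = chartDeriv x y :=
  TangentBundle.continuousLinearMapAt_trivializationAt (symm_mem_source hy)

theorem symmL_eq_chartSymmDeriv {x : M} {y : V}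
    (hy : y ∈ (extChartAt 𝓘(ℝ, V) x).target) :
    (trivializationAt V (TangentSpace 𝓘(ℝ, V)) x).symmL ℝ
      ((extChartAt 𝓘(ℝ, V) x).symm y) = chartSymmDeriv x y := by
  have := TangentBundle.symmL_trivializationAt (I := 𝓘(ℝ, V)) (symm_mem_source hy)
  rw [(extChartAt 𝓘(ℝ, V) x).right_inv hy] at this
  simp only [modelWithCornersSelf_coe, Set.range_id, mfderivWithin_univ] at this
  exact this

/-- The trivialization of the tangent bundle at `x` is the derivative of the preferred chart at `x`,
so smoothness at `x` can be read off from the coordinate expression in that one chart. -/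
theorem isVectorField_iff (E : TangentField V M) :
    IsVectorField E ↔ ∀ x, ContDiffAt ℝ ∞ (chartVector E x) (extChartAt 𝓘(ℝ, V) x x) := by
  refine forall_congr' fun x ↦ ?_
  rw [Bundle.contMDiffAt_section, contMDiffAt_iff_comp_symm]
  refine contDiffAt_iff_of_eventuallyEq ?_
  filter_upwards [target_mem_nhds x] with y hy
  rw [chartVector, ← continuousLinearMapAt_eq_chartDeriv hy]
  symm
  exact Bundle.Trivialization.continuousLinearMapAt_apply_of_mem ℝ _ (symm_mem_source hy) _

theorem cotangent_trivializationAt_apply (x b : M) (ξ : TangentSpace 𝓘(ℝ, V) b →L[ℝ] ℝ) :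
    (trivializationAt (V →L[ℝ] ℝ) (fun x : M ↦ TangentSpace 𝓘(ℝ, V) x →L[ℝ] ℝ) x
      ⟨b, ξ⟩).2 = ξ ∘L (trivializationAt V (TangentSpace 𝓘(ℝ, V)) x).symmL ℝ b := by
  simp only [hom_trivializationAt_apply, ContinuousLinearMap.inCoordinates]
  erw [Bundle.Trivial.continuousLinearMapAt_trivialization]
  rfl

theorem isOneForm_iff (η : CovectorField V M) :
    IsOneForm η ↔ ∀ x, ContDiffAt ℝ ∞ (chartRep η x) (extChartAt 𝓘(ℝ, V) x x) := by
  refine forall_congr' fun x ↦ ?_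
  rw [Bundle.contMDiffAt_section, contMDiffAt_iff_comp_symm]
  refine contDiffAt_iff_of_eventuallyEq ?_
  filter_upwards [target_mem_nhds x] with y hy
  rw [chartRep_eq, ← symmL_eq_chartSymmDeriv hy]
  exact cotangent_trivializationAt_apply x _ _

theorem cotangent_symmL_apply {x b : M} (hb : b ∈ (chartAt V x).source) (α : V →L[ℝ] ℝ) :
    (trivializationAt (V →L[ℝ] ℝ) (fun x : M ↦ TangentSpace 𝓘(ℝ, V) x →L[ℝ] ℝ) x).symmL ℝ b α =
      α ∘L (trivializationAt V (TangentSpace 𝓘(ℝ, V)) x).continuousLinearMapAt ℝ b := by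
  have hb1 : b ∈ (trivializationAt V (TangentSpace 𝓘(ℝ, V)) x).baseSet := hb
  have hb' : b ∈ (trivializationAt (V →L[ℝ] ℝ)
      (fun x : M ↦ TangentSpace 𝓘(ℝ, V) x →L[ℝ] ℝ) x).baseSet := ⟨hb, Set.mem_univ _⟩
  set e := trivializationAt (V →L[ℝ] ℝ) (fun x : M ↦ TangentSpace 𝓘(ℝ, V) x →L[ℝ] ℝ) x with he
  have key : ∀ ξ : TangentSpace 𝓘(ℝ, V) b →L[ℝ] ℝ, e.continuousLinearMapAt ℝ b ξ =
      ξ ∘L (trivializationAt V (TangentSpace 𝓘(ℝ, V)) x).symmL ℝ b := fun ξ ↦ by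
    rw [Bundle.Trivialization.continuousLinearMapAt_apply_of_mem ℝ e hb']
    exact cotangent_trivializationAt_apply x b ξ
  -- The trivialization precomposes a covector with `symmL` of the tangent trivialization, so its
  -- inverse precomposes with `continuousLinearMapAt`.
  have h2 := e.symmL_continuousLinearMapAt (R := ℝ) (b := b) hb'
    (α ∘L (trivializationAt V (TangentSpace 𝓘(ℝ, V)) x).continuousLinearMapAt ℝ b)
  rw [← h2, key]
  congr 1
  ext v
  exact congrArg α (Bundle.Trivialization.continuousLinearMapAt_symmL _ hb1 v).symm

theorem isBivectorField_iff (π : BicontravariantField V M) :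
    IsBivectorField π ↔ (∀ x, ContDiffAt ℝ ∞ (chartBivector π x) (extChartAt 𝓘(ℝ, V) x x)) ∧
      ∀ x α β, π x α β = -π x β α := by
  refine (⟨fun h ↦ ⟨h.1, h.2⟩, fun h ↦ ⟨h.1, h.2⟩⟩ : _ ↔ _ ∧ _).trans (and_congr_left fun _ ↦ ?_)
  refine forall_congr' fun x ↦ ?_
  rw [Bundle.contMDiffAt_section, contMDiffAt_iff_comp_symm]
  refine contDiffAt_iff_of_eventuallyEq ?_
  filter_upwards [target_mem_nhds x] with y hy
  ext α β
  have hb := symm_mem_source hy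
  have hR : π ((extChartAt 𝓘(ℝ, V) x).symm y)
      ((trivializationAt (V →L[ℝ] ℝ) (fun x : M ↦ TangentSpace 𝓘(ℝ, V) x →L[ℝ] ℝ) x).symmL ℝ _ α)
      ((trivializationAt (V →L[ℝ] ℝ) (fun x : M ↦ TangentSpace 𝓘(ℝ, V) x →L[ℝ] ℝ) x).symmL ℝ _ β) =
      chartBivector π x y α β := by
    rw [cotangent_symmL_apply hb α, cotangent_symmL_apply hb β,
      continuousLinearMapAt_eq_chartDeriv hy]
    rfl
  refine Eq.trans ?_ hR
  have key : ∀ (x b : M) (ξ : (TangentSpace 𝓘(ℝ, V) b →L[ℝ] ℝ) →L[ℝ] ℝ),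
    (trivializationAt ((V →L[ℝ] ℝ) →L[ℝ] ℝ)
      (fun x : M ↦ (TangentSpace 𝓘(ℝ, V) x →L[ℝ] ℝ) →L[ℝ] ℝ) x
      ⟨b, ξ⟩).2 = ξ ∘L (trivializationAt (V →L[ℝ] ℝ)
        (fun x : M ↦ TangentSpace 𝓘(ℝ, V) x →L[ℝ] ℝ) x).symmL ℝ b := by
    intro x b ξ
    simp only [hom_trivializationAt_apply, ContinuousLinearMap.inCoordinates]
    erw [Bundle.Trivial.continuousLinearMapAt_trivialization]
    rfl
  have hb' : (extChartAt 𝓘(ℝ, V) x).symm y ∈ (trivializationAt ((V →L[ℝ] ℝ) →L[ℝ] ℝ)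
      (fun x : M ↦ (TangentSpace 𝓘(ℝ, V) x →L[ℝ] ℝ) →L[ℝ] ℝ) x).baseSet :=
    ⟨⟨hb, Set.mem_univ _⟩, Set.mem_univ _⟩
  simp only [Function.comp_apply, hom_trivializationAt_apply, ContinuousLinearMap.inCoordinates]
  rw [ContinuousLinearMap.comp_apply,
    Bundle.Trivialization.continuousLinearMapAt_apply_of_mem ℝ _ hb']
  erw [key]
  rfl

end Chart

/-! ### The exterior derivative on manifolds: naturality and independence of the chart. -/

section ExteriorDerivative

variable {V : Type*} [NormedAddCommGroup V] [NormedSpace ℝ V]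
  {M : Type*} [TopologicalSpace M] [ChartedSpace V M]
  {W : Type*} [NormedAddCommGroup W] [NormedSpace ℝ W]
  {G : Type*} [TopologicalSpace G] [ChartedSpace W G]

/-- The exterior derivative of a 1-form at a point, as a form on the model space. -/
def extDerivAt (η : CovectorField V M) (x : M) : V →L[ℝ] V →L[ℝ] ℝ := extDerivOne η x

variable (V W) in
/-- The differential of a map at a point, as a map of the model spaces. -/
def differentialAt (φ : G → M) (x : G) : W →L[ℝ] V := mfderiv 𝓘(ℝ, W) 𝓘(ℝ, V) φ x

theorem extDerivAt_eq (η : CovectorField V M) (x : M) :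
    extDerivAt η x = (flatExtDeriv (chartRep η x) (extChartAt 𝓘(ℝ, V) x x)).bilinearComp
      (show V →L[ℝ] V from mfderiv 𝓘(ℝ, V) 𝓘(ℝ, V) (extChartAt 𝓘(ℝ, V) x) x)
      (show V →L[ℝ] V from mfderiv 𝓘(ℝ, V) 𝓘(ℝ, V) (extChartAt 𝓘(ℝ, V) x) x) := rfl

theorem extDerivAt_skew (η : CovectorField V M) (x : M) (v w : V) :
    extDerivAt η x v w = -extDerivAt η x w v :=
  flatExtDeriv_skew _ _ _ _

variable (V W) in
/-- The coordinate expression of a map in the preferred charts. -/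
def chartMap (φ : G → M) (x : G) : W → V :=
  extChartAt 𝓘(ℝ, V) (φ x) ∘ φ ∘ (extChartAt 𝓘(ℝ, W) x).symm

theorem chartMap_self (φ : G → M) (x : G) :
    chartMap V W φ x (extChartAt 𝓘(ℝ, W) x x) = extChartAt 𝓘(ℝ, V) (φ x) (φ x) := by
  simp [chartMap]

theorem chartRep_sub (η η' : CovectorField V M) (x : M) :
    chartRep (η - η') x = chartRep η x - chartRep η' x := by
  funext y
  exact ContinuousLinearMap.sub_comp _ _ _

theorem contDiffAt_chartMap {φ : G → M} {x : G} {n : WithTop ℕ∞}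
    (hφ : ContMDiffAt 𝓘(ℝ, W) 𝓘(ℝ, V) n φ x) :
    ContDiffAt ℝ n (chartMap V W φ x) (extChartAt 𝓘(ℝ, W) x x) := by
  have := (contMDiffAt_iff.1 hφ).2
  rwa [modelWithCornersSelf_coe, Set.range_id, contDiffWithinAt_univ] at this

variable [IsManifold 𝓘(ℝ, V) ∞ M] [IsManifold 𝓘(ℝ, W) ∞ G]

/-- The preferred chart at `x` has the identity as its derivative at `x`, in the identification of
the tangent space with `V`. -/
theorem extDerivAt_eq_flatExtDeriv (η : CovectorField V M) (x : M) :
    extDerivAt η x = flatExtDeriv (chartRep η x) (extChartAt 𝓘(ℝ, V) x x) := by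
  rw [extDerivAt_eq, mfderiv_extChartAt_self]
  rfl

theorem extDerivAt_vectorSpace (b : CovectorField V V) (y : V) :
    extDerivAt b y = flatExtDeriv (V := V) b y := by
  have key : ∀ (f : V → V) (z : V), f = id →
      (show V →L[ℝ] ℝ from b (f z)) ∘L (show V →L[ℝ] V from mfderiv 𝓘(ℝ, V) 𝓘(ℝ, V) f z) =
        (show V →L[ℝ] ℝ from b z) := by
    rintro _ z rfl
    rw [mfderiv_id]
    rfl
  have : chartRep b y = (show V → V →L[ℝ] ℝ from b) := funext fun z ↦ key _ z (by simp; rfl)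
  refine (extDerivAt_eq_flatExtDeriv b y).trans ?_
  rw [this]
  rfl

theorem fderiv_chartMap {φ : G → M} {x : G} {y : W} (hy : y ∈ (extChartAt 𝓘(ℝ, W) x).target)
    (hφ : MDifferentiableAt 𝓘(ℝ, W) 𝓘(ℝ, V) φ ((extChartAt 𝓘(ℝ, W) x).symm y))
    (hs : φ ((extChartAt 𝓘(ℝ, W) x).symm y) ∈ (chartAt V (φ x)).source) :
    fderiv ℝ (chartMap V W φ x) y =
      (show V →L[ℝ] V from mfderiv 𝓘(ℝ, V) 𝓘(ℝ, V) (extChartAt 𝓘(ℝ, V) (φ x))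
        (φ ((extChartAt 𝓘(ℝ, W) x).symm y))) ∘L
      differentialAt V W φ ((extChartAt 𝓘(ℝ, W) x).symm y) ∘L
      chartSymmDeriv x y := by
  have h1 : MDifferentiableAt 𝓘(ℝ, W) 𝓘(ℝ, W) (extChartAt 𝓘(ℝ, W) x).symm y := by
    have := mdifferentiableWithinAt_extChartAt_symm hy
    rwa [modelWithCornersSelf_coe, Set.range_id, mdifferentiableWithinAt_univ] at this
  have h2 : MDifferentiableAt 𝓘(ℝ, V) 𝓘(ℝ, V) (extChartAt 𝓘(ℝ, V) (φ x))
      (φ ((extChartAt 𝓘(ℝ, W) x).symm y)) := mdifferentiableAt_extChartAt hs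
  rw [← mfderiv_eq_fderiv, chartMap, mfderiv_comp y h2 (hφ.comp y h1), mfderiv_comp y hφ h1]
  rfl

theorem chartSymmDeriv_comp_mfderiv_extChartAt {x p : M} (hp : p ∈ (extChartAt 𝓘(ℝ, V) x).source) :
    chartSymmDeriv x (extChartAt 𝓘(ℝ, V) x p) ∘L
      (show V →L[ℝ] V from mfderiv 𝓘(ℝ, V) 𝓘(ℝ, V) (extChartAt 𝓘(ℝ, V) x) p) =
        ContinuousLinearMap.id ℝ V := by
  have := mfderivWithin_extChartAt_symm_comp_mfderiv_extChartAt' hp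
  simp only [modelWithCornersSelf_coe, Set.range_id, mfderivWithin_univ] at this
  exact this

/-- The coordinate expression of a pullback. -/
theorem chartRep_pullbackOne {φ : G → M} {x : G} (hφ : ContMDiffAt 𝓘(ℝ, W) 𝓘(ℝ, V) 1 φ x)
    (B : CovectorField V M) :
    chartRep (pullbackOne φ B) x =ᶠ[nhds (extChartAt 𝓘(ℝ, W) x x)]
      fun y ↦ chartRep B (φ x) (chartMap V W φ x y) ∘L fderiv ℝ (chartMap V W φ x) y := by
  have hcont : Filter.Tendsto (extChartAt 𝓘(ℝ, W) x).symm (nhds (extChartAt 𝓘(ℝ, W) x x))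
      (nhds x) := by
    have := continuousAt_extChartAt_symm (I := 𝓘(ℝ, W)) x
    rwa [ContinuousAt, extChartAt_to_inv] at this
  have h1 := hcont.eventually ((contMDiffAt_iff_contMDiffAt_nhds (by simp)).1 hφ |>.mono
    fun z hz ↦ hz.mdifferentiableAt (by simp))
  have h2 := hcont.eventually (hφ.continuousAt.eventually
    ((chartAt V (φ x)).open_source.mem_nhds (mem_chart_source V (φ x))))
  filter_upwards [target_mem_nhds x, h1, h2] with y hy hd hs
  rw [fderiv_chartMap hy hd hs, chartRep_eq, chartRep_eq]
  have hs' : φ ((extChartAt 𝓘(ℝ, W) x).symm y) ∈ (extChartAt 𝓘(ℝ, V) (φ x)).source := by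
    rw [extChartAt_source]; exact hs
  have hinv : (extChartAt 𝓘(ℝ, V) (φ x)).symm (chartMap V W φ x y) =
      φ ((extChartAt 𝓘(ℝ, W) x).symm y) := (extChartAt 𝓘(ℝ, V) (φ x)).left_inv hs'
  have hid := chartSymmDeriv_comp_mfderiv_extChartAt hs'
  ext v
  have hv := DFunLike.congr_fun hid (differentialAt V W φ ((extChartAt 𝓘(ℝ, W) x).symm y) (chartSymmDeriv x y v))
  have hB : ∀ z, (extChartAt 𝓘(ℝ, V) (φ x)).symm (chartMap V W φ x y) = z →
      (show V →L[ℝ] ℝ from B ((extChartAt 𝓘(ℝ, V) (φ x)).symm (chartMap V W φ x y))) =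
        (show V →L[ℝ] ℝ from B z) := by rintro z rfl; rfl
  rw [hB _ hinv]
  exact congrArg (show V →L[ℝ] ℝ from B _) hv.symm

/-- The exterior derivative commutes with pullback. -/
theorem extDerivAt_pullbackOne {φ : G → M} {x : G} (hφ : ContMDiffAt 𝓘(ℝ, W) 𝓘(ℝ, V) ∞ φ x)
    {B : CovectorField V M} (hB : IsOneForm B) :
    extDerivAt (pullbackOne φ B) x =
      (extDerivAt B (φ x)).bilinearComp
        (differentialAt V W φ x)
        (differentialAt V W φ x) := by
  have hcm : chartMap V W φ x (extChartAt 𝓘(ℝ, W) x x) = extChartAt 𝓘(ℝ, V) (φ x) (φ x) :=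
    chartMap_self φ x
  have h1 : DifferentiableAt ℝ (chartRep B (φ x)) (chartMap V W φ x (extChartAt 𝓘(ℝ, W) x x)) := by
    rw [hcm]
    exact ((isOneForm_iff B).1 hB (φ x)).differentiableAt (by simp)
  have h2 : ContDiffAt ℝ 2 (chartMap V W φ x) (extChartAt 𝓘(ℝ, W) x x) :=
    (contDiffAt_chartMap hφ).of_le (WithTop.coe_le_coe.2 (le_top (a := (2 : ℕ∞))))
  have h3 : flatExtDeriv (chartRep (pullbackOne φ B) x) (extChartAt 𝓘(ℝ, W) x x) =
      flatExtDeriv (fun y ↦ chartRep B (φ x) (chartMap V W φ x y) ∘L fderiv ℝ (chartMap V W φ x) y)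
        (extChartAt 𝓘(ℝ, W) x x) := by
    have := chartRep_pullbackOne (hφ.of_le (by simp)) B
    rw [flatExtDeriv, flatExtDeriv, this.fderiv_eq]
  have h4 := fderiv_chartMap (V := V) (W := W) (φ := φ) (x := x) (mem_extChartAt_target x)
    (by rw [extChartAt_to_inv]; exact hφ.mdifferentiableAt (by simp))
    (by rw [extChartAt_to_inv]; exact mem_chart_source V (φ x))
  have h5 : chartSymmDeriv x (extChartAt 𝓘(ℝ, W) x x) = ContinuousLinearMap.id ℝ W := by
    have := mfderivWithin_range_extChartAt_symm (I := 𝓘(ℝ, W)) (x := x)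
    simp only [modelWithCornersSelf_coe, Set.range_id, mfderivWithin_univ] at this
    exact this
  have h6 : fderiv ℝ (chartMap V W φ x) (extChartAt 𝓘(ℝ, W) x x) =
      differentialAt V W φ x := by
    rw [h4, h5, extChartAt_to_inv, mfderiv_extChartAt_self]
    rfl
  rw [extDerivAt_eq_flatExtDeriv, extDerivAt_eq_flatExtDeriv, h3, flatExtDeriv_pullback h1 h2,
    hcm, h6]

theorem isOneForm_pullbackOne {φ : G → M} (hφ : ContMDiff 𝓘(ℝ, W) 𝓘(ℝ, V) ∞ φ)
    {B : CovectorField V M} (hB : IsOneForm B) : IsOneForm (V := W) (pullbackOne φ B) := by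
  refine (isOneForm_iff (V := W) _).2 fun x ↦ ?_
  have hφx : ContMDiffAt 𝓘(ℝ, W) 𝓘(ℝ, V) ∞ φ x := hφ x
  refine ContDiffAt.congr_of_eventuallyEq ?_ (chartRep_pullbackOne (hφx.of_le (by simp)) B)
  have h1 := contDiffAt_chartMap hφx
  refine ContDiffAt.clm_comp (ContDiffAt.comp (g := chartRep B (φ x)) _ ?_ h1) (h1.fderiv_right (by simp))
  rw [chartMap_self]
  exact (isOneForm_iff B).1 hB (φ x)

theorem isOneForm_sub {η η' : CovectorField V M} (h : IsOneForm η) (h' : IsOneForm η') :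
    IsOneForm (η - η') := by
  refine (isOneForm_iff _).2 fun x ↦ ?_
  rw [chartRep_sub]
  exact ((isOneForm_iff η).1 h x).sub ((isOneForm_iff η').1 h' x)

theorem extDerivAt_sub {η η' : CovectorField V M} (h : IsOneForm η) (h' : IsOneForm η') (x : M) :
    extDerivAt (η - η') x =
      extDerivAt η x -
        extDerivAt η' x := by
  rw [extDerivAt_eq_flatExtDeriv, extDerivAt_eq_flatExtDeriv, extDerivAt_eq_flatExtDeriv,
    chartRep_sub, flatExtDeriv, fderiv_sub (((isOneForm_iff η).1 h x).differentiableAt (by simp))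
      (((isOneForm_iff η').1 h' x).differentiableAt (by simp))]
  ext v w
  simp [flatExtDeriv]
  ring

/-- The exterior derivative may be computed in any chart. -/
theorem extDerivAt_chart {B : CovectorField V M} (hB : IsOneForm B) {x : M} {y : V}
    (hy : y ∈ (extChartAt 𝓘(ℝ, V) x).target) :
    (extDerivAt B ((extChartAt 𝓘(ℝ, V) x).symm y)).bilinearComp
      (chartSymmDeriv x y) (chartSymmDeriv x y) = flatExtDeriv (chartRep B x) y := by
  have h : ContMDiffAt 𝓘(ℝ, V) 𝓘(ℝ, V) ∞ (extChartAt 𝓘(ℝ, V) x).symm y :=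
    (contMDiffOn_extChartAt_symm x).contMDiffAt ((isOpen_extChartAt_target x).mem_nhds hy)
  -- `chartRep B x` is by definition the pullback of `B` along the inverse chart, and the preferred
  -- charts of `V` are the identity.
  exact (extDerivAt_pullbackOne h hB).symm.trans (extDerivAt_vectorSpace _ y)

end ExteriorDerivative

/-! ### Brackets and the Jacobi identities in charts. -/

section JacobiChart

variable {V : Type*} [NormedAddCommGroup V] [NormedSpace ℝ V]
  {M : Type*} [TopologicalSpace M] [ChartedSpace V M]

theorem flatBracket_congr {P P' : V → (V →L[ℝ] ℝ) →L[ℝ] (V →L[ℝ] ℝ) →L[ℝ] ℝ} {f f' g g' : V → ℝ}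
    {y : V} (hP : P y = P' y) (hf : f =ᶠ[nhds y] f') (hg : g =ᶠ[nhds y] g') :
    flatBracket P f g y = flatBracket P' f' g' y := by
  rw [flatBracket, flatBracket, hP, hf.fderiv_eq, hg.fderiv_eq]

theorem flatDerivAlong_congr {e : V → V} {f f' : V → ℝ} {y : V} (hf : f =ᶠ[nhds y] f') :
    flatDerivAlong e f y = flatDerivAlong e f' y := by
  rw [flatDerivAlong, flatDerivAlong, hf.fderiv_eq]

theorem chartBivector_skew {π : BicontravariantField V M} (hπ : ∀ x α β, π x α β = -π x β α)
    (x : M) (y : V) (α β : V →L[ℝ] ℝ) : chartBivector π x y α β = -chartBivector π x y β α := by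
  rw [chartBivector_apply, chartBivector_apply]
  exact hπ ((extChartAt 𝓘(ℝ, V) x).symm y) _ _

variable [IsManifold 𝓘(ℝ, V) ∞ M]

theorem mdifferentiableAt_extChartAt_symm {x : M} {y : V}
    (hy : y ∈ (extChartAt 𝓘(ℝ, V) x).target) :
    MDifferentiableAt 𝓘(ℝ, V) 𝓘(ℝ, V) (extChartAt 𝓘(ℝ, V) x).symm y := by
  have := mdifferentiableWithinAt_extChartAt_symm hy
  rwa [modelWithCornersSelf_coe, Set.range_id, mdifferentiableWithinAt_univ] at this

theorem mvfderiv_chart (f : M → ℝ) {x : M} {y : V} (hy : y ∈ (extChartAt 𝓘(ℝ, V) x).target) :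
    (show V →L[ℝ] ℝ from mvfderiv 𝓘(ℝ, V) f ((extChartAt 𝓘(ℝ, V) x).symm y)) =
      fderiv ℝ (f ∘ (extChartAt 𝓘(ℝ, V) x).symm) y ∘L chartDeriv x y := by
  have h1 := mdifferentiableAt_extChartAt_symm hy
  -- No smoothness of `f` is needed: where `f` is not differentiable, neither is its coordinate
  -- expression, and both derivatives take the default value `0`.
  by_cases hf : MDifferentiableAt 𝓘(ℝ, V) 𝓘(ℝ, ℝ) f ((extChartAt 𝓘(ℝ, V) x).symm y)
  · have h2 : fderiv ℝ (f ∘ (extChartAt 𝓘(ℝ, V) x).symm) y =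
        (show V →L[ℝ] ℝ from mvfderiv 𝓘(ℝ, V) f ((extChartAt 𝓘(ℝ, V) x).symm y)) ∘L
          chartSymmDeriv x y := by
      rw [← mfderiv_eq_fderiv, mfderiv_comp y hf h1]
      rfl
    rw [h2, ContinuousLinearMap.comp_assoc, chartSymmDeriv_comp_chartDeriv hy]
    rfl
  · have h0 : ¬ DifferentiableAt ℝ (f ∘ (extChartAt 𝓘(ℝ, V) x).symm) y := by
      intro h
      apply hf
      have hs : (extChartAt 𝓘(ℝ, V) x).symm y ∈ (chartAt V x).source := symm_mem_source hy
      have h3 := h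
      rw [← (extChartAt 𝓘(ℝ, V) x).right_inv hy] at h3
      refine (h3.mdifferentiableAt.comp _ (mdifferentiableAt_extChartAt hs)).congr_of_eventuallyEq ?_
      filter_upwards [(chartAt V x).open_source.mem_nhds hs] with p hp
      rw [← extChartAt_source 𝓘(ℝ, V)] at hp
      simp only [Function.comp_apply]
      rw [(extChartAt 𝓘(ℝ, V) x).left_inv hp]
    rw [fderiv_zero_of_not_differentiableAt h0, mvfderiv, mfderiv_zero_of_not_mdifferentiableAt hf]
    rfl

theorem bivectorBracket_chart (π : BicontravariantField V M) (f g : M → ℝ) {x : M} {y : V}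
    (hy : y ∈ (extChartAt 𝓘(ℝ, V) x).target) :
    bivectorBracket π f g ((extChartAt 𝓘(ℝ, V) x).symm y) =
      flatBracket (chartBivector π x) (f ∘ (extChartAt 𝓘(ℝ, V) x).symm)
        (g ∘ (extChartAt 𝓘(ℝ, V) x).symm) y := by
  rw [flatBracket, chartBivector_apply, ← mvfderiv_chart f hy, ← mvfderiv_chart g hy]
  rfl

theorem derivAlong_chart (E : TangentField V M) (f : M → ℝ) {x : M} {y : V}
    (hy : y ∈ (extChartAt 𝓘(ℝ, V) x).target) :
    derivAlong E f ((extChartAt 𝓘(ℝ, V) x).symm y) =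
      flatDerivAlong (chartVector E x) (f ∘ (extChartAt 𝓘(ℝ, V) x).symm) y := by
  rw [flatDerivAlong, chartVector]
  exact DFunLike.congr_fun (mvfderiv_chart f hy) _

theorem bivectorBracket_self (π : BicontravariantField V M) (f g : M → ℝ) (x : M) :
    bivectorBracket π f g x = flatBracket (chartBivector π x) (f ∘ (extChartAt 𝓘(ℝ, V) x).symm)
        (g ∘ (extChartAt 𝓘(ℝ, V) x).symm) (extChartAt 𝓘(ℝ, V) x x) := by
  rw [← bivectorBracket_chart π f g (mem_extChartAt_target x), extChartAt_to_inv]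

theorem derivAlong_self (E : TangentField V M) (f : M → ℝ) (x : M) :
    derivAlong E f x = flatDerivAlong (chartVector E x) (f ∘ (extChartAt 𝓘(ℝ, V) x).symm)
      (extChartAt 𝓘(ℝ, V) x x) := by
  rw [← derivAlong_chart E f (mem_extChartAt_target x), extChartAt_to_inv]

/-- Equality near the point, not only at it, is required because an outer bracket differentiates the
inner one. -/
theorem bivectorBracket_comp_symm (π : BicontravariantField V M) (f g : M → ℝ) (x : M) :
    bivectorBracket π f g ∘ (extChartAt 𝓘(ℝ, V) x).symm =ᶠ[nhds (extChartAt 𝓘(ℝ, V) x x)]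
      flatBracket (chartBivector π x) (f ∘ (extChartAt 𝓘(ℝ, V) x).symm)
        (g ∘ (extChartAt 𝓘(ℝ, V) x).symm) :=
  (target_mem_nhds x).mono fun _ hy ↦ bivectorBracket_chart π f g hy

theorem derivAlong_comp_symm (E : TangentField V M) (f : M → ℝ) (x : M) :
    derivAlong E f ∘ (extChartAt 𝓘(ℝ, V) x).symm =ᶠ[nhds (extChartAt 𝓘(ℝ, V) x x)]
      flatDerivAlong (chartVector E x) (f ∘ (extChartAt 𝓘(ℝ, V) x).symm) :=
  (target_mem_nhds x).mono fun _ hy ↦ derivAlong_chart E f hy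

theorem bivectorBracket_bivectorBracket (π : BicontravariantField V M) (f g h : M → ℝ) (x : M) :
    bivectorBracket π (bivectorBracket π f g) h x =
      flatBracket (chartBivector π x) (flatBracket (chartBivector π x)
        (f ∘ (extChartAt 𝓘(ℝ, V) x).symm) (g ∘ (extChartAt 𝓘(ℝ, V) x).symm))
        (h ∘ (extChartAt 𝓘(ℝ, V) x).symm) (extChartAt 𝓘(ℝ, V) x x) := by
  rw [bivectorBracket_self]
  exact flatBracket_congr rfl (bivectorBracket_comp_symm π f g x) .rfl

theorem schoutenVectorBivector_chart (E : TangentField V M) (π : BicontravariantField V M)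
    (f g : M → ℝ) (x : M) :
    schoutenVectorBivector E π f g x =
      flatDerivAlong (chartVector E x) (flatBracket (chartBivector π x)
          (f ∘ (extChartAt 𝓘(ℝ, V) x).symm) (g ∘ (extChartAt 𝓘(ℝ, V) x).symm))
          (extChartAt 𝓘(ℝ, V) x x) -
        flatBracket (chartBivector π x) (flatDerivAlong (chartVector E x)
          (f ∘ (extChartAt 𝓘(ℝ, V) x).symm)) (g ∘ (extChartAt 𝓘(ℝ, V) x).symm)
          (extChartAt 𝓘(ℝ, V) x x) -
        flatBracket (chartBivector π x) (f ∘ (extChartAt 𝓘(ℝ, V) x).symm)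
          (flatDerivAlong (chartVector E x) (g ∘ (extChartAt 𝓘(ℝ, V) x).symm))
          (extChartAt 𝓘(ℝ, V) x x) := by
  rw [schoutenVectorBivector, derivAlong_self, bivectorBracket_self, bivectorBracket_self]
  congr 1
  · congr 1
    · exact flatDerivAlong_congr (bivectorBracket_comp_symm π f g x)
    · exact flatBracket_congr rfl (derivAlong_comp_symm E f x) .rfl
  · exact flatBracket_congr rfl .rfl (derivAlong_comp_symm E g x)

/-- A Jacobi structure is a pair of tensor fields whose coordinate expressions satisfy the Jacobi
identities. -/
theorem isJacobiStructure_iff [FiniteDimensional ℝ V] (π : BicontravariantField V M)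
    (E : TangentField V M) :
    IsJacobiStructure π E ↔ IsBivectorField π ∧ IsVectorField E ∧
      ∀ x, IsFlatJacobi (chartBivector π x) (chartVector E x) (extChartAt 𝓘(ℝ, V) x x) := by
  constructor
  · intro H
    refine ⟨H.bivector, H.vector, fun x ↦ ?_⟩
    have hP := (((isBivectorField_iff π).1 H.bivector).1 x).differentiableAt (by simp)
    have he := ((isVectorField_iff E).1 H.vector x).differentiableAt (by simp)
    -- The test functions are linear functions of the coordinates; the next facts identify the germs
    -- of their coordinate expressions, and of the brackets of these, with those of the linear
    -- functions.
    have hsm : ∀ f : V →L[ℝ] ℝ,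
        ContMDiffAt 𝓘(ℝ, V) 𝓘(ℝ, ℝ) ∞ (f ∘ extChartAt 𝓘(ℝ, V) x) x := fun f ↦
      f.contDiff.contMDiff.contMDiffAt.comp x contMDiffAt_extChartAt
    have hev : ∀ f : V →L[ℝ] ℝ, (f ∘ extChartAt 𝓘(ℝ, V) x) ∘ (extChartAt 𝓘(ℝ, V) x).symm
        =ᶠ[nhds (extChartAt 𝓘(ℝ, V) x x)] f := fun f ↦ by
      filter_upwards [target_mem_nhds x] with y hy
      simp only [Function.comp_apply]
      rw [(extChartAt 𝓘(ℝ, V) x).right_inv hy]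
    have hev1 : ∀ f : V →L[ℝ] ℝ, flatDerivAlong (chartVector E x)
        ((f ∘ extChartAt 𝓘(ℝ, V) x) ∘ (extChartAt 𝓘(ℝ, V) x).symm)
        =ᶠ[nhds (extChartAt 𝓘(ℝ, V) x x)] flatDerivAlong (chartVector E x) f := fun f ↦
      (hev f).eventuallyEq_nhds.mono fun y hy ↦ flatDerivAlong_congr hy
    have hev2 : ∀ f g : V →L[ℝ] ℝ, flatBracket (chartBivector π x)
        ((f ∘ extChartAt 𝓘(ℝ, V) x) ∘ (extChartAt 𝓘(ℝ, V) x).symm)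
        ((g ∘ extChartAt 𝓘(ℝ, V) x) ∘ (extChartAt 𝓘(ℝ, V) x).symm)
        =ᶠ[nhds (extChartAt 𝓘(ℝ, V) x x)] flatBracket (chartBivector π x) f g := fun f g ↦
      ((hev f).eventuallyEq_nhds.and (hev g).eventuallyEq_nhds).mono
        fun y hy ↦ flatBracket_congr rfl hy.1 hy.2
    refine isFlatJacobi_of_linear hP he (chartBivector_skew H.bivector.skew _ _) ?_ ?_
    · intro f g h
      have := H.schouten_self x _ _ _ (hsm f) (hsm g) (hsm h)
      rw [schoutenSelf, wedgeVectorBivector, bivectorBracket_bivectorBracket,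
        bivectorBracket_bivectorBracket, bivectorBracket_bivectorBracket] at this
      simp only [bivectorBracket_self, derivAlong_self] at this
      rw [flatBracket_congr rfl (hev2 f g) (hev h), flatBracket_congr rfl (hev2 g h) (hev f),
        flatBracket_congr rfl (hev2 h f) (hev g), (hev2 f g).self_of_nhds,
        (hev2 g h).self_of_nhds, (hev2 h f).self_of_nhds, (hev1 f).self_of_nhds,
        (hev1 g).self_of_nhds, (hev1 h).self_of_nhds] at this
      linarith
    · intro f g
      have := H.schouten_vector x _ _ (hsm f) (hsm g)
      rwa [schoutenVectorBivector_chart, flatDerivAlong_congr (hev2 f g),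
        flatBracket_congr rfl (hev1 f) (hev g), flatBracket_congr rfl (hev f) (hev1 g)] at this
  · rintro ⟨h1, h2, H⟩
    have h1' := (isBivectorField_iff π).1 h1
    have hc : ∀ {x : M} {f : M → ℝ}, ContMDiffAt 𝓘(ℝ, V) 𝓘(ℝ, ℝ) ∞ f x →
        ContDiffAt ℝ 2 (f ∘ (extChartAt 𝓘(ℝ, V) x).symm) (extChartAt 𝓘(ℝ, V) x x) := fun hf ↦
      (contMDiffAt_iff_comp_symm.1 hf).of_le (WithTop.coe_le_coe.2 (le_top (a := (2 : ℕ∞))))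
    refine ⟨h1, h2, fun x f g h hf hg hh ↦ ?_, fun x f g hf hg ↦ ?_⟩
    · rw [schoutenSelf, wedgeVectorBivector, bivectorBracket_bivectorBracket,
        bivectorBracket_bivectorBracket, bivectorBracket_bivectorBracket]
      simp only [bivectorBracket_self, derivAlong_self]
      rw [(H x).schouten_self ((h1'.1 x).differentiableAt (by simp))
        (chartBivector_skew h1.skew _ _) (hc hf) (hc hg) (hc hh)]
    · rw [schoutenVectorBivector_chart]
      exact (H x).schouten_vector ((h1'.1 x).differentiableAt (by simp))
        (((isVectorField_iff E).1 h2 x).differentiableAt (by simp))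
        (chartBivector_skew h1.skew _ _) (hc hf) (hc hg)

end JacobiChart

/-! ### Smoothness and Jacobi identities of the transformed pairs on a vector space. -/

section FlatTransforms

variable {V : Type*} [NormedAddCommGroup V] [NormedSpace ℝ V]

theorem contDiffAt_flatExtDeriv {b : V → V →L[ℝ] ℝ} {y : V} (hb : ContDiffAt ℝ ∞ b y) :
    ContDiffAt ℝ ∞ (flatExtDeriv b) y := by
  have h : ContDiffAt ℝ ∞ (fderiv ℝ b) y := hb.fderiv_right (by simp)
  let T : (V →L[ℝ] V →L[ℝ] ℝ) →L[ℝ] V →L[ℝ] V →L[ℝ] ℝ :=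
    (ContinuousLinearMap.flipₗᵢ ℝ V V ℝ).toContinuousLinearEquiv
  exact h.sub (T.contDiff.contDiffAt.comp y h)

variable [FiniteDimensional ℝ V]

/-- Both `P` and `e` are recovered from the sharp map by fixed linear operations, evaluation at `(α,
0)` and at `(0, 1)`. -/
theorem contDiffAt_of_pairSharp {n : WithTop ℕ∞} {P : V → (V →L[ℝ] ℝ) →L[ℝ] (V →L[ℝ] ℝ) →L[ℝ] ℝ}
    {e : V → V} {y : V} (h : ContDiffAt ℝ n (fun z ↦ pairSharp (P z) (e z)) y) :
    ContDiffAt ℝ n P y ∧ ContDiffAt ℝ n e y := by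
  constructor
  · have hP : P = fun z ↦ NormedSpace.inclusionInDoubleDual ℝ V ∘L
        ContinuousLinearMap.fst ℝ V ℝ ∘L pairSharp (P z) (e z) ∘L
        ContinuousLinearMap.inl ℝ (V →L[ℝ] ℝ) ℝ := by
      ext z α β
      simp [pairSharp, apply_sharp]
    rw [hP]
    exact contDiffAt_const.clm_comp (contDiffAt_const.clm_comp (h.clm_comp contDiffAt_const))
  · have he : e = fun z ↦ ContinuousLinearMap.fst ℝ V ℝ (pairSharp (P z) (e z) (0, 1)) := by
      ext z
      simp [pairSharp]
    rw [he]
    exact contDiffAt_const.clm_apply (h.clm_apply contDiffAt_const)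

variable {P P' : V → (V →L[ℝ] ℝ) →L[ℝ] (V →L[ℝ] ℝ) →L[ℝ] ℝ} {e e' : V → V} {b : V → V →L[ℝ] ℝ}
  {y : V}

/-- A pair `(P, e)` that is minus the inverse of `(db, b)` is smooth and satisfies the Jacobi
identities. -/
theorem isFlatJacobi_of_inverse (hb : ContDiffAt ℝ ∞ b y)
    (hrel : ∀ᶠ z in nhds y, ∀ a,
      pairFlat (flatExtDeriv b z) (b z) (pairSharp (P z) (e z) a) = -a) :
    ContDiffAt ℝ ∞ P y ∧ ContDiffAt ℝ ∞ e y ∧ IsFlatJacobi P e y := by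
  have hΩ : ContDiffAt ℝ ∞ (fun z ↦ pairFlat (flatExtDeriv b z) (b z)) y :=
    contDiffAt_pairFlat (contDiffAt_flatExtDeriv hb) hb
  have hinv : ∀ z, (∀ a, pairFlat (flatExtDeriv b z) (b z) (pairSharp (P z) (e z) a) = -a) →
      (pairFlat (flatExtDeriv b z) (b z)).IsInvertible := fun z hz ↦ by
    have hs : Function.Surjective (pairFlat (flatExtDeriv b z) (b z)) := fun a ↦
      ⟨pairSharp (P z) (e z) (-a), by rw [hz, neg_neg]⟩
    exact isInvertible_of_bijective
      ⟨((pairFlat (flatExtDeriv b z) (b z)).toLinearMap.injective_iff_surjective_of_finrank_eq_finrank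
        finrank_dual_prod_eq.symm).2 hs, hs⟩
  -- Near `y` the sharp map is `-Ω⁻¹`, and inversion is smooth at invertible maps.
  have hS : ContDiffAt ℝ ∞ (fun z ↦ pairSharp (P z) (e z)) y := by
    have h1 := (hinv y hrel.self_of_nhds).contDiffAt_map_inverse (n := ∞)
    refine (h1.comp y hΩ).neg.congr_of_eventuallyEq ?_
    filter_upwards [hrel] with z hz
    refine ContinuousLinearMap.ext fun a ↦ ?_
    have := (hinv z hz).inverse_apply_eq.2 (hz a).symm
    rw [map_neg] at this
    exact this.symm
  obtain ⟨hP, he⟩ := contDiffAt_of_pairSharp hS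
  refine ⟨hP, he, (isFlatJacobi_iff_poissonDefect (hP.differentiableAt (by simp))
    (he.differentiableAt (by simp))).2 ?_⟩
  exact poissonDefect_of_inverse (hS.differentiableAt (by simp)) (hΩ.differentiableAt (by simp)) hrel
    (pairFlat_skew _ (flatExtDeriv_skew b y))
    (closedDefect_pairFlat (hb.of_le (WithTop.coe_le_coe.2 (le_top (a := (2 : ℕ∞))))))

/-- Gauge transformations preserve smoothness and the Jacobi identities. -/
theorem IsFlatJacobi.gauge (H : IsFlatJacobi P e y) (hP : ContDiffAt ℝ ∞ P y)
    (he : ContDiffAt ℝ ∞ e y) (hb : ContDiffAt ℝ ∞ b y)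
    (hrel : ∀ᶠ z in nhds y, Function.Bijective (gaugeEndo (flatExtDeriv b z) (b z) (P z) (e z)) ∧
      ∀ a, pairSharp (P' z) (e' z) (gaugeEndo (flatExtDeriv b z) (b z) (P z) (e z) a) =
        pairSharp (P z) (e z) a)
    (hskew : ∀ α β, P' y α β = -P' y β α) :
    ContDiffAt ℝ ∞ P' y ∧ ContDiffAt ℝ ∞ e' y ∧ IsFlatJacobi P' e' y := by
  have hΩ : ContDiffAt ℝ ∞ (fun z ↦ pairFlat (flatExtDeriv b z) (b z)) y :=
    contDiffAt_pairFlat (contDiffAt_flatExtDeriv hb) hb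
  have hS : ContDiffAt ℝ ∞ (fun z ↦ pairSharp (P z) (e z)) y := contDiffAt_pairSharp hP he
  have hΦ : ContDiffAt ℝ ∞ (fun z ↦ gaugeEndo (flatExtDeriv b z) (b z) (P z) (e z)) y :=
    contDiffAt_const.add (hΩ.clm_comp hS)
  have hS' : ContDiffAt ℝ ∞ (fun z ↦ pairSharp (P' z) (e' z)) y := by
    have h1 := (isInvertible_of_bijective hrel.self_of_nhds.1).contDiffAt_map_inverse (n := ∞)
    refine (hS.clm_comp (h1.comp y hΦ)).congr_of_eventuallyEq ?_
    filter_upwards [hrel] with z hz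
    refine ContinuousLinearMap.ext fun a ↦ ?_
    obtain ⟨a, rfl⟩ := hz.1.2 a
    have := (isInvertible_of_bijective hz.1).inverse_apply_eq.2
      (rfl : gaugeEndo (flatExtDeriv b z) (b z) (P z) (e z) a = _)
    rw [hz.2]
    exact congrArg (pairSharp (P z) (e z)) this.symm
  obtain ⟨hP', he'⟩ := contDiffAt_of_pairSharp hS'
  refine ⟨hP', he', (isFlatJacobi_iff_poissonDefect (hP'.differentiableAt (by simp))
    (he'.differentiableAt (by simp))).2 ?_⟩
  exact poissonDefect_of_gauge (hS.differentiableAt (by simp)) (hS'.differentiableAt (by simp))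
    (hΩ.differentiableAt (by simp)) (hrel.mono fun z hz ↦ hz.2) hrel.self_of_nhds.1.2
    (pairFlat_skew _ (flatExtDeriv_skew b y)) (pairSharp_skew _ hskew)
    (closedDefect_pairFlat (hb.of_le (WithTop.coe_le_coe.2 (le_top (a := (2 : ℕ∞))))))
    ((isFlatJacobi_iff_poissonDefect (hP.differentiableAt (by simp))
      (he.differentiableAt (by simp))).1 H)

end FlatTransforms

/-! ### Contact and gauge-transformed structures are Jacobi structures on manifolds. -/

section ChartTransforms

variable {V : Type*} [NormedAddCommGroup V] [NormedSpace ℝ V]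

theorem pairPullback_comp {W U : Type*} [NormedAddCommGroup W] [NormedSpace ℝ W]
    [NormedAddCommGroup U] [NormedSpace ℝ U] (F : W →L[ℝ] V) (F' : U →L[ℝ] W)
    (a : (V →L[ℝ] ℝ) × ℝ) : pairPullback F' (pairPullback F a) = pairPullback (F ∘L F') a := rfl

theorem pairPush_comp {W U : Type*} [NormedAddCommGroup W] [NormedSpace ℝ W]
    [NormedAddCommGroup U] [NormedSpace ℝ U] (F : W →L[ℝ] V) (F' : U →L[ℝ] W)
    (u : U × ℝ) : pairPush F (pairPush F' u) = pairPush (F ∘L F') u := rfl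

theorem pairPullback_id (a : (V →L[ℝ] ℝ) × ℝ) :
    pairPullback (ContinuousLinearMap.id ℝ V) a = a := rfl

theorem pairPush_id (u : V × ℝ) : pairPush (ContinuousLinearMap.id ℝ V) u = u := rfl

theorem pairPullback_add {W : Type*} [NormedAddCommGroup W] [NormedSpace ℝ W] (F : W →L[ℝ] V)
    (a b : (V →L[ℝ] ℝ) × ℝ) : pairPullback F (a + b) = pairPullback F a + pairPullback F b := rfl

/-- Invariance under a change of frame: forms are pulled back by `C`, multivectors pushed forward by
`A = C⁻¹`, and the inner factors `C A` cancel. Admissibility thus passes to coordinates. -/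
theorem gaugeEndo_conj [FiniteDimensional ℝ V] (θ : V →L[ℝ] V →L[ℝ] ℝ) (b : V →L[ℝ] ℝ)
    (P : (V →L[ℝ] ℝ) →L[ℝ] (V →L[ℝ] ℝ) →L[ℝ] ℝ) (e : V) {A C : V →L[ℝ] V}
    (hAC : A ∘L C = ContinuousLinearMap.id ℝ V) (hCA : C ∘L A = ContinuousLinearMap.id ℝ V)
    (a : (V →L[ℝ] ℝ) × ℝ) :
    gaugeEndo (θ.bilinearComp C C) (b ∘L C) (P.bilinearComp (A.precomp ℝ) (A.precomp ℝ)) (A e) a =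
      pairPullback C (gaugeEndo θ b P e (pairPullback A a)) := by
  rw [gaugeEndo_apply, gaugeEndo_apply, pairPush_pairFlat_pullback,
    ← pairPush_pairSharp_pairPullback (F := A) (Q := P) (z := e) (fun _ _ ↦ rfl) rfl,
    pairPush_comp, hCA, pairPush_id, pairPullback_add, pairPullback_comp, hAC, pairPullback_id]

variable {M : Type*} [TopologicalSpace M] [ChartedSpace V M]

theorem pairSharp_chart [FiniteDimensional ℝ V] (π : BicontravariantField V M) (E : TangentField V M) (x : M) (y : V)
    (a : (V →L[ℝ] ℝ) × ℝ) :
    pairSharp (chartBivector π x y) (chartVector E x y) a =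
      pairPush (chartDeriv x y) (pairSharp (W := V) (π ((extChartAt 𝓘(ℝ, V) x).symm y))
        (E ((extChartAt 𝓘(ℝ, V) x).symm y)) (pairPullback (chartDeriv x y) a)) :=
  (pairPush_pairSharp_pairPullback (fun _ _ ↦ rfl) rfl a).symm

variable [IsManifold 𝓘(ℝ, V) ∞ M]

theorem pairFlat_chart {η : CovectorField V M} (hη : IsOneForm η) {x : M} {y : V}
    (hy : y ∈ (extChartAt 𝓘(ℝ, V) x).target) (u : V × ℝ) :
    pairFlat (flatExtDeriv (chartRep η x) y) (chartRep η x y) u =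
      pairPullback (chartSymmDeriv x y) (pairFlat (extDerivAt η ((extChartAt 𝓘(ℝ, V) x).symm y))
        (η ((extChartAt 𝓘(ℝ, V) x).symm y)) (pairPush (chartSymmDeriv x y) u)) := by
  rw [← extDerivAt_chart hη hy, chartRep_eq]
  exact pairPush_pairFlat_pullback _ _ _ _

variable [FiniteDimensional ℝ V]

theorem gaugeEndo_chart {B : CovectorField V M} (hB : IsOneForm B) (π : BicontravariantField V M)
    (E : TangentField V M) {x : M} {y : V}
    (hy : y ∈ (extChartAt 𝓘(ℝ, V) x).target) (a : (V →L[ℝ] ℝ) × ℝ) :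
    gaugeEndo (flatExtDeriv (chartRep B x) y) (chartRep B x y) (chartBivector π x y)
        (chartVector E x y) a =
      pairPullback (chartSymmDeriv x y) (gaugeEndo (W := V)
        (extDerivAt B ((extChartAt 𝓘(ℝ, V) x).symm y)) (B ((extChartAt 𝓘(ℝ, V) x).symm y))
        (π ((extChartAt 𝓘(ℝ, V) x).symm y)) (E ((extChartAt 𝓘(ℝ, V) x).symm y))
        (pairPullback (chartDeriv x y) a)) := by
  rw [← extDerivAt_chart hB hy, chartRep_eq]
  exact gaugeEndo_conj _ _ _ _ (chartDeriv_comp_chartSymmDeriv hy)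
    (chartSymmDeriv_comp_chartDeriv hy) a

/-- The Jacobi structure of a nondegenerate 1-form. -/
theorem isJacobiStructure_contact {η : CovectorField V M} (hη : IsOneForm η)
    (hinj : ∀ x, Function.Injective (pairFlat (W := V) (extDerivAt η x) (η x))) :
    IsJacobiStructure (contactBivector η) (contactVector η) := by
  have key : ∀ x : M, ContDiffAt ℝ ∞ (chartBivector (contactBivector η) x)
      (extChartAt 𝓘(ℝ, V) x x) ∧
      ContDiffAt ℝ ∞ (chartVector (contactVector η) x) (extChartAt 𝓘(ℝ, V) x x) ∧
      IsFlatJacobi (chartBivector (contactBivector η) x) (chartVector (contactVector η) x)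
        (extChartAt 𝓘(ℝ, V) x x) := by
    intro x
    refine isFlatJacobi_of_inverse ((isOneForm_iff η).1 hη x) ?_
    filter_upwards [target_mem_nhds x] with y hy
    intro a
    -- In coordinates `Ω S` is the conjugate of the pointwise product, which is `-Id` by
    -- `pairFlat_contact`.
    rw [pairSharp_chart, pairFlat_chart hη hy, pairPush_comp, chartSymmDeriv_comp_chartDeriv hy,
      pairPush_id]
    have h := pairFlat_contact (extDerivAt_skew η _) (hinj ((extChartAt 𝓘(ℝ, V) x).symm y))
      (pairPullback (chartDeriv x y) a)
    refine (congrArg (pairPullback (chartSymmDeriv x y)) h).trans ?_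
    have h2 : pairPullback (chartSymmDeriv x y) (pairPullback (chartDeriv x y) a) = a := by
      rw [pairPullback_comp, chartDeriv_comp_chartSymmDeriv hy, pairPullback_id]
    exact congrArg Neg.neg h2
  exact (isJacobiStructure_iff _ _).2 ⟨(isBivectorField_iff _).2 ⟨fun x ↦ (key x).1,
    fun x α β ↦ contactBivectorAt_skew (W := V) (η x) (extDerivAt_skew η x) α β⟩,
    (isVectorField_iff _).2 fun x ↦ (key x).2.1, fun x ↦ (key x).2.2⟩

/-- Gauge transformations of Jacobi structures are Jacobi structures. -/
theorem IsJacobiStructure.gauge {π : BicontravariantField V M} {E : TangentField V M}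
    (H : IsJacobiStructure π E) {B : CovectorField V M} (hB : IsOneForm B)
    (hadm : IsAdmissible π E B) :
    IsJacobiStructure (gaugeBivector B π E) (gaugeVector B π E) := by
  obtain ⟨h1, h2, h3⟩ := (isJacobiStructure_iff π E).1 H
  have hskew : ∀ x α β, gaugeBivector B π E x α β = -gaugeBivector B π E x β α := fun x α β ↦
    gaugedBivector_skew (W := V) (extDerivAt_skew B x) (h1.skew x) (hadm x) α β
  have key : ∀ x : M, ContDiffAt ℝ ∞ (chartBivector (gaugeBivector B π E) x)
      (extChartAt 𝓘(ℝ, V) x x) ∧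
      ContDiffAt ℝ ∞ (chartVector (gaugeVector B π E) x) (extChartAt 𝓘(ℝ, V) x x) ∧
      IsFlatJacobi (chartBivector (gaugeBivector B π E) x) (chartVector (gaugeVector B π E) x)
        (extChartAt 𝓘(ℝ, V) x x) := by
    intro x
    refine (h3 x).gauge (((isBivectorField_iff π).1 h1).1 x) ((isVectorField_iff E).1 h2 x)
      ((isOneForm_iff B).1 hB x) ?_ (chartBivector_skew hskew x _)
    filter_upwards [target_mem_nhds x] with y hy
    have hAB : ∀ a : (V →L[ℝ] ℝ) × ℝ,
        pairPullback (chartDeriv x y) (pairPullback (chartSymmDeriv x y) a) = a := fun a ↦ by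
      rw [pairPullback_comp, chartSymmDeriv_comp_chartDeriv hy, pairPullback_id]
    have hBA : ∀ a : (V →L[ℝ] ℝ) × ℝ,
        pairPullback (chartSymmDeriv x y) (pairPullback (chartDeriv x y) a) = a := fun a ↦ by
      rw [pairPullback_comp, chartDeriv_comp_chartSymmDeriv hy, pairPullback_id]
    have hΦ := hadm ((extChartAt 𝓘(ℝ, V) x).symm y)
    refine ⟨⟨fun a a' h ↦ ?_, fun a ↦ ?_⟩, fun a ↦ ?_⟩
    · rw [gaugeEndo_chart hB π E hy, gaugeEndo_chart hB π E hy] at h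
      have := congrArg (pairPullback (chartDeriv x y)) h
      rw [hAB, hAB] at this
      have := congrArg (pairPullback (chartSymmDeriv x y)) (hΦ.1 this)
      rwa [hBA, hBA] at this
    · obtain ⟨c, hc⟩ := hΦ.2 (pairPullback (chartDeriv x y) a)
      refine ⟨pairPullback (chartSymmDeriv x y) c, ?_⟩
      rw [gaugeEndo_chart hB π E hy, hAB]
      exact (congrArg (pairPullback (chartSymmDeriv x y)) hc).trans (hBA a)
    · rw [pairSharp_chart, pairSharp_chart, gaugeEndo_chart hB π E hy, hAB]
      exact congrArg (pairPush (chartDeriv x y)) (pairSharp_gauged_gaugeEndo (W := V)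
        (extDerivAt_skew B _) (h1.skew _) hΦ _)
  exact (isJacobiStructure_iff _ _).2 ⟨(isBivectorField_iff _).2 ⟨fun x ↦ (key x).1, hskew⟩,
    (isVectorField_iff _).2 fun x ↦ (key x).2.1, fun x ↦ (key x).2.2⟩

end ChartTransforms

/-! ### The pointwise algebra applied to `η - φ^* B`. -/

section SubPullback

variable {V : Type*} [NormedAddCommGroup V] [NormedSpace ℝ V]
  {W : Type*} [NormedAddCommGroup W] [NormedSpace ℝ W]

theorem extDerivAt_sub_pullbackOne
    {M : Type*} [TopologicalSpace M] [ChartedSpace V M] [IsManifold 𝓘(ℝ, V) ∞ M]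
    {G : Type*} [TopologicalSpace G] [ChartedSpace W G] [IsManifold 𝓘(ℝ, W) ∞ G]
    {η : CovectorField W G} (hη : IsOneForm η) {φ : G → M}
    (hφ : ContMDiff 𝓘(ℝ, W) 𝓘(ℝ, V) ∞ φ) {B : CovectorField V M} (hB : IsOneForm B) (x : G) :
    extDerivAt (η - pullbackOne φ B) x = extDerivAt η x -
      (extDerivAt B (φ x)).bilinearComp (differentialAt V W φ x) (differentialAt V W φ x) := by
  rw [extDerivAt_sub hη (isOneForm_pullbackOne hφ hB), extDerivAt_pullbackOne (hφ x) hB]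

variable [FiniteDimensional ℝ V] [FiniteDimensional ℝ W]
  {F : W →L[ℝ] V} {θ θ' : W →L[ℝ] W →L[ℝ] ℝ} {η η' : W →L[ℝ] ℝ}
  {σ : V →L[ℝ] V →L[ℝ] ℝ} {b : V →L[ℝ] ℝ}
  {P : (V →L[ℝ] ℝ) →L[ℝ] (V →L[ℝ] ℝ) →L[ℝ] ℝ} {e : V}

/-- Subtracting the pullback of an admissible pair preserves nondegeneracy. -/
theorem contact_sub_pullback_injective (hθ : ∀ v w, θ v w = -θ w v)
    (hinj : Function.Injective (pairFlat θ η))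
    (hFP : ∀ α β, contactBivectorAt θ η (α ∘L F) (β ∘L F) = P α β)
    (hFe : F (contactVectorAt θ η) = e) (hΦ : Function.Bijective (gaugeEndo σ b P e))
    (hθ' : θ' = θ - σ.bilinearComp F F) (hη' : η' = η - b ∘L F) :
    Function.Injective (pairFlat θ' η') := by
  rw [hθ', hη']
  exact pairFlat_sub_pullback_injective (pairFlat_contact hθ hinj) hinj hFP hFe hΦ

/-- Subtracting the pullback of a pair corresponds to its gauge transformation in the target. -/
theorem contact_sub_pullback_map (hθ : ∀ v w, θ v w = -θ w v)
    (hinj : Function.Injective (pairFlat θ η))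
    (hFP : ∀ α β, contactBivectorAt θ η (α ∘L F) (β ∘L F) = P α β)
    (hFe : F (contactVectorAt θ η) = e) (hΦ : Function.Bijective (gaugeEndo σ b P e))
    (hσ : ∀ v w, σ v w = -σ w v) (hP : ∀ α β, P α β = -P β α) (hskew : ∀ v w, θ' v w = -θ' w v)
    (hθ' : θ' = θ - σ.bilinearComp F F) (hη' : η' = η - b ∘L F) :
    (∀ α β, contactBivectorAt θ' η' (α ∘L F) (β ∘L F) = gaugedBivector σ b P e α β) ∧
      F (contactVectorAt θ' η') = gaugedVector σ b P e := by
  have hinj' := contact_sub_pullback_injective hθ hinj hFP hFe hΦ hθ' hη'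
  subst hθ' hη'
  exact map_contact_sub_pullback (pairPush_contact_sub_pullback (pairFlat_contact hθ hinj) hinj'
    (pairFlat_contact hskew hinj') hFP hFe hσ hP hΦ)

end SubPullback

/-! ### Contact forms and Jacobi maps after subtracting a pullback. -/

section Main

variable {V : Type*} [NormedAddCommGroup V] [NormedSpace ℝ V] [FiniteDimensional ℝ V]
  {M : Type*} [TopologicalSpace M] [ChartedSpace V M] [IsManifold 𝓘(ℝ, V) ∞ M]
  {W : Type*} [NormedAddCommGroup W] [NormedSpace ℝ W] [FiniteDimensional ℝ W]
  {G : Type*} [TopologicalSpace G] [ChartedSpace W G] [IsManifold 𝓘(ℝ, W) ∞ G]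

theorem IsContactForm.pairFlat_injective {η : CovectorField W G} (hη : IsContactForm η) (x : G) :
    Function.Injective (pairFlat (W := W) (extDerivAt η x) (η x)) := by
  obtain ⟨n, hn, h⟩ := hη.nondegenerate
  obtain ⟨v, hv⟩ := h x
  exact pairFlat_injective_of_wedgePowEval hn (extDerivAt_skew η x) hv

theorem isContactForm_of_pairFlat_injective {η : CovectorField W G} (hη : IsOneForm η) {n : ℕ}
    (hn : Module.finrank ℝ W = 2 * n + 1)
    (hinj : ∀ x, Function.Injective (pairFlat (W := W) (extDerivAt η x) (η x))) :
    IsContactForm η :=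
  ⟨hη, n, hn, fun x ↦ exists_wedgePowEval_ne_zero hn (extDerivAt_skew η x) (hinj x)⟩

/-- Subtracting the pullback of an admissible form along a Jacobi map preserves nondegeneracy. -/
theorem IsContactForm.pairFlat_sub_pullbackOne_injective {η : CovectorField W G}
    (hη : IsContactForm η) {π : BicontravariantField V M} {E : TangentField V M} {φ : G → M}
    (hφ : IsJacobiMap φ (contactBivector η) (contactVector η) π E) {B : CovectorField V M}
    (hB : IsOneForm B) (hadm : IsAdmissible π E B) (x : G) :
    Function.Injective (pairFlat (W := W) (extDerivAt (η - pullbackOne φ B) x)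
      ((η - pullbackOne φ B : CovectorField W G) x)) :=
  contact_sub_pullback_injective (W := W) (V := V) (F := differentialAt V W φ x) (η := η x)
    (b := B (φ x)) (extDerivAt_skew η x)
    (hη.pairFlat_injective x) (hφ.map_bivector x) (hφ.map_vector x) (hadm (φ x))
    (extDerivAt_sub_pullbackOne hη.oneForm hφ.smooth hB x) rfl

theorem IsContactForm.isJacobiMap_sub_pullbackOne {η : CovectorField W G}
    (hη : IsContactForm η) {π : BicontravariantField V M} {E : TangentField V M}
    (hπ : ∀ x α β, π x α β = -π x β α) {φ : G → M}
    (hφ : IsJacobiMap φ (contactBivector η) (contactVector η) π E) {B : CovectorField V M}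
    (hB : IsOneForm B) (hadm : IsAdmissible π E B) :
    IsJacobiMap φ (contactBivector (η - pullbackOne φ B)) (contactVector (η - pullbackOne φ B))
      (gaugeBivector B π E) (gaugeVector B π E) := by
  have key := fun x ↦ contact_sub_pullback_map (W := W) (V := V) (F := differentialAt V W φ x)
    (η := η x) (η' := (η - pullbackOne φ B : CovectorField W G) x)
    (b := B (φ x)) (extDerivAt_skew η x)
    (hη.pairFlat_injective x) (hφ.map_bivector x) (hφ.map_vector x) (hadm (φ x))
    (extDerivAt_skew B (φ x)) (hπ (φ x)) (extDerivAt_skew (η - pullbackOne φ B) x)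
    (extDerivAt_sub_pullbackOne hη.oneForm hφ.smooth hB x) rfl
  exact ⟨hφ.smooth, fun x ↦ (key x).1, fun x ↦ (key x).2⟩

end Main

end JacobiGeometry

end

theorem mainTheorem4
    {V : Type*} [NormedAddCommGroup V] [NormedSpace ℝ V] [FiniteDimensional ℝ V]
    {M : Type*} [TopologicalSpace M] [ChartedSpace V M] [IsManifold 𝓘(ℝ, V) ∞ M]
    {W : Type*} [NormedAddCommGroup W] [NormedSpace ℝ W] [FiniteDimensional ℝ W]
    {G : Type*} [TopologicalSpace G] [ChartedSpace W G] [IsManifold 𝓘(ℝ, W) ∞ G]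
    (η : JacobiGeometry.CovectorField W G) (hη : JacobiGeometry.IsContactForm η)
    (π : JacobiGeometry.BicontravariantField V M) (E : JacobiGeometry.TangentField V M)
    (hπE : JacobiGeometry.IsJacobiStructure π E)
    (φ : G → M)
    (hφ : JacobiGeometry.IsJacobiMap φ
      (JacobiGeometry.contactBivector η) (JacobiGeometry.contactVector η) π E)
    (B : JacobiGeometry.CovectorField V M) (hB : JacobiGeometry.IsOneForm B)
    (hadm : JacobiGeometry.IsAdmissible π E B) :
    JacobiGeometry.IsContactForm (η - JacobiGeometry.pullbackOne φ B) ∧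
    JacobiGeometry.IsJacobiStructure
      (JacobiGeometry.contactBivector (η - JacobiGeometry.pullbackOne φ B))
      (JacobiGeometry.contactVector (η - JacobiGeometry.pullbackOne φ B)) ∧
    JacobiGeometry.IsJacobiStructure
      (JacobiGeometry.gaugeBivector B π E) (JacobiGeometry.gaugeVector B π E) ∧
    JacobiGeometry.IsJacobiMap φ
      (JacobiGeometry.contactBivector (η - JacobiGeometry.pullbackOne φ B))
      (JacobiGeometry.contactVector (η - JacobiGeometry.pullbackOne φ B))
      (JacobiGeometry.gaugeBivector B π E) (JacobiGeometry.gaugeVector B π E) := by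
  have hinj := hη.pairFlat_sub_pullbackOne_injective hφ hB hadm
  have hform := JacobiGeometry.isOneForm_sub hη.oneForm
    (JacobiGeometry.isOneForm_pullbackOne hφ.smooth hB)
  -- Only the odd dimension of `G` is taken from `η` here; the nonvanishing top form of `η - φ^* B`
  -- is rebuilt from `hinj`.
  obtain ⟨n, hn, -⟩ := hη.nondegenerate
  exact ⟨JacobiGeometry.isContactForm_of_pairFlat_injective hform hn hinj,
    JacobiGeometry.isJacobiStructure_contact hform hinj, hπE.gauge hB hadm,
    hη.isJacobiMap_sub_pullbackOne hπE.bivector.skew hφ hB hadm⟩
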